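/- Let $f$ be a Lebesgue integrable real function on $[-\pi,\pi]$ with $\int_{-\pi}^{\pi} f(\theta)\,d\theta=0$, with Fourier coefficients $\alpha_k=\frac1\pi\int_{-\pi}^{\pi}\cos(k\theta)f(\theta)\,d\theta$ and $\beta_k=\frac1\pi\int_{-\pi}^{\pi}\sin(k\theta)f(\theta)\,d\theta$. Let $w(z)=\sum_{k\ge 1}(\alpha_k-i\beta_k)z^k$, an analytic function on the open unit disk, and write $w(\rho e^{i\theta})=u(\rho,\theta)+i\,v(\rho,\theta)$; thus $f(\theta)=u(1,\theta):=\lim_{\rho\to1^-}u(\rho,\theta)$ for almost every $\theta$. Let $g$ be the Fourier-conjugate function of $f$, that is, a real function with $g(\theta)=v(1,\theta):=\lim_{\rho\to1^-}v(\rho,\theta)$ for almost every $\theta\in[-\pi,\pi]$. The compact Hilbert transform of an integrable real function $h$ on $[-\pi,\pi]$ is $$\mathcal H_c[h](\theta)=-\frac1{2\pi}\,\mathrm{PV}\!\!\int_{-\pi}^{\pi}\cot\!\left(\frac{\theta_1-\theta}{2}\right)h(\theta_1)\,d\theta_1,$$ where the principal value is $\mathrm{PV}\!\int_{-\pi}^{\pi}=\lim_{\varepsilon\to0^+}\int_{[-\pi,\pi]\setminus(\theta-\varepsilon,\theta+\varepsilon)}$.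 Then, for almost every $\theta\in[-\pi,\pi]$, the principal value $\mathcal H_c[f](\theta)$ exists and $g(\theta)=\mathcal H_c[f](\theta)$. If moreover $g$ is integrable on $[-\pi,\pi]$, then for almost every $\theta\in[-\pi,\pi]$ the principal value $\mathcal H_c[g](\theta)$ exists and $f(\theta)=\mathcal H_c^{-1}[g](\theta)$, where the inverse transform is $\mathcal H_c^{-1}=-\mathcal H_c$, that is, $$f(\theta)=\frac1{2\pi}\,\mathrm{PV}\!\!\int_{-\pi}^{\pi}\cot\!\left(\frac{\theta_1-\theta}{2}\right)g(\theta_1)\,d\theta_1 .$$ -/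

import Mathlib

namespace CompactHilbert

/-- The Fourier coefficient `α_k = (1/π) ∫_{-π}^{π} cos(kθ) f(θ) dθ` (for `k = 0` as well). -/
noncomputable def fourierCos (f : ℝ → ℝ) (k : ℕ) : ℝ :=
  (1 / Real.pi) * ∫ θ in (-Real.pi)..Real.pi, Real.cos (k * θ) * f θ

/-- The Fourier coefficient `β_k = (1/π) ∫_{-π}^{π} sin(kθ) f(θ) dθ`. -/
noncomputable def fourierSin (f : ℝ → ℝ) (k : ℕ) : ℝ :=
  (1 / Real.pi) * ∫ θ in (-Real.pi)..Real.pi, Real.sin (k * θ) * f θ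

/-- The Taylor coefficients `c_0 = α_0 / 2` and `c_k = α_k - i β_k` for `k ≥ 1`. -/
noncomputable def taylorCoeff (f : ℝ → ℝ) (k : ℕ) : ℂ :=
  if k = 0 then (fourierCos f 0 : ℂ) / 2
  else (fourierCos f k : ℂ) - Complex.I * (fourierSin f k : ℂ)

/-- The inner analytic function `w(z) = ∑ c_k z^k` of the integrable real function `f`;
the series converges absolutely for `|z| < 1` since the coefficients are bounded. -/
noncomputable def innerAnalytic (f : ℝ → ℝ) (z : ℂ) : ℂ :=
  ∑' k : ℕ, taylorCoeff f k * z ^ k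

/-- `g` is the Fourier-conjugate of `f`: with `w = u + i v` the inner analytic function of `f`,
`g(θ) = v(1, θ) = lim_{ρ → 1⁻} v(ρ, θ)` for almost every `θ` of the unit circle. -/
def IsFourierConjugate (f g : ℝ → ℝ) : Prop :=
  ∀ᵐ θ : ℝ ∂(MeasureTheory.volume.restrict (Set.Icc (-Real.pi) Real.pi)),
    Filter.Tendsto
      (fun ρ : ℝ => (innerAnalytic f ((ρ : ℂ) * Complex.exp (Complex.I * (θ : ℂ)))).im)
      (nhdsWithin 1 (Set.Iio 1)) (nhds (g θ))

/-- The interval `[-π, π]` with the symmetric interval `(θ - ε, θ + ε)` removed. -/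
def punctured (θ ε : ℝ) : Set ℝ :=
  Set.Icc (-Real.pi) Real.pi \ Set.Ioo (θ - ε) (θ + ε)

/-- `L` is the Cauchy principal value over `[-π, π]` of the integral of `F`, whose only
non-integrable singularity is at `θ`. -/
def HasCauchyPV (F : ℝ → ℝ) (θ L : ℝ) : Prop :=
  (∀ ε : ℝ, 0 < ε → MeasureTheory.IntegrableOn F (punctured θ ε)) ∧
    Filter.Tendsto (fun ε : ℝ => ∫ θ₁ in punctured θ ε, F θ₁)
      (nhdsWithin 0 (Set.Ioi 0)) (nhds L)

open Classical in
/-- The Cauchy principal value as a number (`0` if it does not exist). -/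
noncomputable def cauchyPV (F : ℝ → ℝ) (θ : ℝ) : ℝ :=
  if h : ∃ L, HasCauchyPV F θ L then h.choose else 0

/-- The integrand `cot((θ₁ - θ)/2) f(θ₁)` of the compact Hilbert transform. -/
noncomputable def cotIntegrand (f : ℝ → ℝ) (θ θ₁ : ℝ) : ℝ :=
  Real.cos ((θ₁ - θ) / 2) / Real.sin ((θ₁ - θ) / 2) * f θ₁

/-- The principal value defining the compact Hilbert transform of `f` at `θ` exists. -/
def HilbertExistsAt (f : ℝ → ℝ) (θ : ℝ) : Prop :=
  ∃ L, HasCauchyPV (cotIntegrand f θ) θ L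

/-- The compact Hilbert transform
`H_c[f](θ) = -(1/2π) PV ∫_{-π}^{π} cot((θ₁ - θ)/2) f(θ₁) dθ₁`. -/
noncomputable def hilbert (f : ℝ → ℝ) (θ : ℝ) : ℝ :=
  -(1 / (2 * Real.pi)) * cauchyPV (cotIntegrand f θ) θ

/-- The inverse transform
`H_c⁻¹[g](θ) = -H_c[g](θ) = (1/2π) PV ∫_{-π}^{π} cot((θ₁ - θ)/2) g(θ₁) dθ₁`. -/
noncomputable def hilbertInv (g : ℝ → ℝ) (θ : ℝ) : ℝ :=
  -hilbert g θ

theorem HasCauchyPV.cauchyPV_eq {F : ℝ → ℝ} {θ L : ℝ} (h : HasCauchyPV F θ L) :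
    cauchyPV F θ = L := by
  have hex : ∃ L, HasCauchyPV F θ L := ⟨L, h⟩
  rw [cauchyPV, dif_pos hex]
  exact tendsto_nhds_unique hex.choose_spec.2 h.2

end CompactHilbert

namespace CompactHilbert

open Filter Set Topology MeasureTheory

/-! Summing the power series under the integral gives the Herglotz–Schwarz formula: on the circle of
radius `r`, the real and imaginary parts of `w` are `1/(2π)` times the integrals of `f` against the
Poisson and conjugate Poisson kernels in `t - θ`. As `r → 1` the conjugate kernel tends to `-cot((t
- θ)/2)`. With `δ = 1 - r`, the difference between it and the cotangent truncated at distance `δ` is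
`O(δ/(δ² + (t - θ)²))`, an approximate identity. Both kernels integrate constants to zero, so `f`
may be replaced by `f - f θ`. Hence at each interior Lebesgue point the truncated integral plus `2π
v` tends to `0` (`tendsto_im_innerAnalytic_add_truncated`), and the principal value exists because
the radial limit of `v` does.

For the inverse it suffices that `-f` is the conjugate of `g`; the first half then applies to `g`.
By Fatou's theorem (`tendsto_re_innerAnalytic`) this reduces to the inner function of `g` being `-i
w`, that is, to the Taylor coefficients of `w` being the Fourier coefficients of the boundary
function `f + i g`. Integrability of `f + i g` alone does not give this for an arbitrary analytic
function. Here `w = w₁ - w₂` with `Re w₁, Re w₂ ≥ 0`, so the contractive multipliers `1/((1 + a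
w₁)(1 + a w₂))` make `w` bounded and tend to `1` as `a → 0`. `integral_boundary_eq_coeff` passes to
the limit. -/

/-! ### Approximate identities at Lebesgue points. -/

/-- Take the least admissible `j`. If `j > 0`, minimality gives `|s| > 2 ^ (j - 1) * δ`, whence the
factor `4`. -/
lemma exists_dyadic_kernel_bound {δ : ℝ} (hδ : 0 < δ) (s : ℝ) :
    ∃ j : ℕ, |s| ≤ 2 ^ j * δ ∧ δ / (δ ^ 2 + s ^ 2) ≤ 4 / (4 ^ j * δ) := by
  have hex : ∃ j : ℕ, |s| ≤ 2 ^ j * δ := by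
    obtain ⟨j, hj⟩ := pow_unbounded_of_one_lt (|s| / δ) (one_lt_two (α := ℝ))
    exact ⟨j, ((div_lt_iff₀ hδ).1 hj).le⟩
  classical
  refine ⟨Nat.find hex, Nat.find_spec hex, ?_⟩
  rcases hj : Nat.find hex with _ | j
  · rw [div_le_div_iff₀ (by positivity) (by positivity)]
    nlinarith [sq_nonneg s, sq_nonneg δ]
  · have hlt : 2 ^ j * δ < |s| := not_le.1 (Nat.find_min hex (by omega))
    have hsq : (2 ^ j * δ) ^ 2 ≤ s ^ 2 := by
      rw [← sq_abs s]; gcongr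
    have h4 : (2 ^ j * δ) ^ 2 = 4 ^ j * δ ^ 2 := by
      rw [mul_pow, ← pow_mul, mul_comm j 2, pow_mul]; norm_num
    rw [div_le_div_iff₀ (by positivity) (by positivity), pow_succ]
    nlinarith [sq_nonneg δ]

/-- At each point a single dyadic ball already dominates the kernel, and the other terms are
nonnegative. Working with `lintegral` makes the exchange of sum and integral free; summability
serves only to return to real numbers. -/
lemma integral_kernel_le_tsum {φ : ℝ → ℝ} (hφ : Integrable φ) (hφ0 : ∀ t, 0 ≤ φ t) (θ : ℝ)
    {δ : ℝ} (hδ : 0 < δ)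
    (hs : Summable fun j : ℕ => 4 / (4 ^ j * δ) * ∫ t in Metric.closedBall θ (2 ^ j * δ), φ t) :
    ∫ t, δ / (δ ^ 2 + (t - θ) ^ 2) * φ t ≤
      ∑' j : ℕ, 4 / (4 ^ j * δ) * ∫ t in Metric.closedBall θ (2 ^ j * δ), φ t := by
  have hnn : ∀ j : ℕ, 0 ≤ 4 / (4 ^ j * δ) * ∫ t in Metric.closedBall θ (2 ^ j * δ), φ t :=
    fun j => mul_nonneg (by positivity) (integral_nonneg hφ0)
  rw [integral_eq_lintegral_of_nonneg_ae
    (Eventually.of_forall fun t => mul_nonneg (by positivity) (hφ0 t))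
    ((Measurable.aestronglyMeasurable (by fun_prop)).mul hφ.1)]
  apply ENNReal.toReal_le_of_le_ofReal (tsum_nonneg hnn)
  have hterm : ∀ j : ℕ, ENNReal.ofReal
      (4 / (4 ^ j * δ) * ∫ t in Metric.closedBall θ (2 ^ j * δ), φ t) =
      ∫⁻ t, (Metric.closedBall θ (2 ^ j * δ)).indicator
        (fun t => ENNReal.ofReal (4 / (4 ^ j * δ) * φ t)) t := by
    intro j
    rw [lintegral_indicator Metric.isClosed_closedBall.measurableSet, ← integral_const_mul,
      ofReal_integral_eq_lintegral_ofReal (hφ.integrableOn.const_mul _)]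
    exact Eventually.of_forall fun t => mul_nonneg (by positivity) (hφ0 t)
  rw [ENNReal.ofReal_tsum_of_nonneg hnn hs]
  simp_rw [hterm]
  rw [← lintegral_tsum]
  · apply lintegral_mono
    intro t
    obtain ⟨j, hj, hk⟩ := exists_dyadic_kernel_bound hδ (t - θ)
    refine le_trans ?_ (ENNReal.le_tsum j)
    rw [indicator_of_mem (by simpa [Real.dist_eq] using hj)]
    exact ENNReal.ofReal_le_ofReal (mul_le_mul_of_nonneg_right hk (hφ0 t))
  · intro j
    exact (ENNReal.measurable_ofReal.comp_aemeasurable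
      (hφ.1.aemeasurable.const_mul _)).indicator Metric.isClosed_closedBall.measurableSet

/-- The kernels `δ / (δ² + s²)` form an approximate identity (up to a factor) at Lebesgue points. -/
theorem tendsto_integral_kernel {φ : ℝ → ℝ} (hφ : Integrable φ) (hφ0 : ∀ t, 0 ≤ φ t) (θ : ℝ)
    (hθ : Tendsto (fun h : ℝ => h⁻¹ * ∫ t in Metric.closedBall θ h, φ t) (𝓝[>] 0) (𝓝 0)) :
    Tendsto (fun δ : ℝ => ∫ t, δ / (δ ^ 2 + (t - θ) ^ 2) * φ t) (𝓝[>] 0) (𝓝 0) := by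
  set A : ℝ → ℝ := fun h : ℝ => h⁻¹ * ∫ t in Metric.closedBall θ h, φ t with hA
  have hA0 : ∀ h, 0 < h → 0 ≤ A h := fun h hh =>
    mul_nonneg (by positivity) (integral_nonneg hφ0)
  -- Small radii are controlled by the limit hypothesis, large ones by the total integral of `φ`.
  obtain ⟨C, hC⟩ : ∃ C, ∀ h, 0 < h → A h ≤ C := by
    have h1 := hθ.eventually (gt_mem_nhds (zero_lt_one (α := ℝ)))
    obtain ⟨η, hη, hη1⟩ := mem_nhdsGT_iff_exists_Ioc_subset.1 h1
    have hη : 0 < η := hη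
    refine ⟨max 1 (η⁻¹ * ∫ t, φ t), fun h hh => ?_⟩
    rcases le_or_gt h η with hle | hgt
    · exact le_max_of_le_left (le_of_lt (hη1 ⟨hh, hle⟩))
    · apply le_max_of_le_right
      have : ∫ t in Metric.closedBall θ h, φ t ≤ ∫ t, φ t :=
        setIntegral_le_integral hφ (Eventually.of_forall hφ0)
      have h2 : 0 ≤ ∫ t in Metric.closedBall θ h, φ t := integral_nonneg hφ0
      simp only [hA]
      gcongr
  -- The ball has radius `2 ^ j * δ` while the kernel is of size `1 / (4 ^ j * δ)`; the surplus `2 ^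
  -- (-j)` supplies a dominating geometric series independent of `δ`.
  have hterm : ∀ δ : ℝ, 0 < δ → ∀ j : ℕ,
      4 / (4 ^ j * δ) * ∫ t in Metric.closedBall θ (2 ^ j * δ), φ t =
        4 * (1 / 2) ^ j * A (2 ^ j * δ) := by
    intro δ hδ j
    have : (4 : ℝ) ^ j = 2 ^ j * 2 ^ j := by rw [← mul_pow]; norm_num
    simp only [hA, this, one_div, inv_pow]
    field_simp
  have hbd : ∀ δ : ℝ, 0 < δ → ∀ j : ℕ, ‖4 * (1 / 2) ^ j * A (2 ^ j * δ)‖ ≤ 4 * C * (1 / 2) ^ j := by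
    intro δ hδ j
    have h0 := hA0 (2 ^ j * δ) (by positivity)
    rw [Real.norm_of_nonneg (by positivity)]
    nlinarith [hC (2 ^ j * δ) (by positivity), pow_pos (one_half_pos (α := ℝ)) j]
  have hsum : Summable fun j : ℕ => 4 * C * (1 / 2 : ℝ) ^ j :=
    (summable_geometric_two).mul_left _
  have hlim : Tendsto (fun δ : ℝ => ∑' j : ℕ, 4 * (1 / 2) ^ j * A (2 ^ j * δ)) (𝓝[>] 0)
      (𝓝 (∑' _ : ℕ, (0 : ℝ))) := by
    apply tendsto_tsum_of_dominated_convergence hsum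
    · intro j
      suffices h : Tendsto (fun δ : ℝ => 2 ^ j * δ) (𝓝[>] 0) (𝓝[>] 0) by
        simpa using (hθ.comp h).const_mul (4 * (1 / 2 : ℝ) ^ j)
      refine tendsto_nhdsWithin_iff.2 ⟨?_, ?_⟩
      · have : Tendsto (fun δ : ℝ => 2 ^ j * δ) (𝓝 0) (𝓝 (2 ^ j * 0)) :=
          (continuous_const.mul continuous_id).tendsto 0
        rw [mul_zero] at this
        exact this.mono_left nhdsWithin_le_nhds
      · filter_upwards [self_mem_nhdsWithin] with δ hδ
        have : 0 < δ := hδ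
        exact mul_pos (by positivity) this
    · filter_upwards [self_mem_nhdsWithin] with δ hδ j using hbd δ hδ j
  rw [tsum_zero] at hlim
  refine tendsto_of_tendsto_of_tendsto_of_le_of_le' tendsto_const_nhds hlim ?_ ?_
  · filter_upwards [self_mem_nhdsWithin] with δ hδ
    have : 0 < δ := hδ
    exact integral_nonneg fun t => mul_nonneg (by positivity) (hφ0 t)
  · filter_upwards [self_mem_nhdsWithin] with δ hδ
    have h := integral_kernel_le_tsum hφ hφ0 θ hδ (by
      simp_rw [hterm δ hδ]
      exact Summable.of_norm_bounded hsum (hbd δ hδ))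
    simp_rw [hterm δ hδ] at h
    exact h

/-- `θ` is a Lebesgue point of `f` restricted to `[-π, π]`. -/
def IsLebesguePoint (f : ℝ → ℝ) (θ : ℝ) : Prop :=
  Tendsto (fun h : ℝ => h⁻¹ * ∫ t in Metric.closedBall θ h,
    (Icc (-Real.pi) Real.pi).indicator (fun t => |f t - f θ|) t) (𝓝[>] 0) (𝓝 0)

/-- Lebesgue differentiation for the extension of `f` by zero. The balls have length `2 * h`, so the
averages are doubled to match the normalisation `h⁻¹`. -/
lemma ae_isLebesguePoint {f : ℝ → ℝ} (hf : IntegrableOn f (Icc (-Real.pi) Real.pi)) :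
    ∀ᵐ θ ∂(volume.restrict (Icc (-Real.pi) Real.pi)), IsLebesguePoint f θ := by
  set S := Icc (-Real.pi) Real.pi with hS
  have hSm : MeasurableSet S := measurableSet_Icc
  have hF : Integrable (S.indicator f) := hf.integrable_indicator hSm
  rw [ae_restrict_iff' hSm]
  filter_upwards [(Besicovitch.vitaliFamily (volume : Measure ℝ)).ae_tendsto_average_norm_sub
    hF.locallyIntegrable] with θ hθ hθS
  rw [IsLebesguePoint, ← hS]
  have h1 := (hθ.comp (Besicovitch.tendsto_filterAt volume θ)).const_mul 2
  rw [mul_zero] at h1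
  refine tendsto_of_tendsto_of_tendsto_of_le_of_le' tendsto_const_nhds h1 ?_ ?_
  · filter_upwards [self_mem_nhdsWithin] with h hh
    have : 0 < h := hh
    exact mul_nonneg (by positivity)
      (integral_nonneg fun t => indicator_nonneg (fun _ _ => abs_nonneg _) t)
  · filter_upwards [self_mem_nhdsWithin] with h hh
    have hh : 0 < h := hh
    simp only [Function.comp, average_eq, smul_eq_mul, measureReal_restrict_apply_univ]
    rw [Real.volume_real_closedBall hh.le, ← mul_assoc]
    have hc : 2 * (2 * h)⁻¹ = h⁻¹ := by field_simp
    rw [hc]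
    apply mul_le_mul_of_nonneg_left _ (by positivity)
    have hloc : IntegrableOn (fun t => ‖S.indicator f t - S.indicator f θ‖)
        (Metric.closedBall θ h) :=
      (hF.integrableOn.sub (integrableOn_const
        (isCompact_closedBall θ h).measure_lt_top.ne)).norm
    refine integral_mono_of_nonneg ?_ hloc ?_
    · exact Eventually.of_forall fun t => indicator_nonneg (fun _ _ => abs_nonneg _) t
    · refine Eventually.of_forall fun t => ?_
      by_cases ht : t ∈ S
      · simp [ht, hθS]
      · simp [ht]

lemma integrableOn_bdd_mul {f K : ℝ → ℝ} {s : Set ℝ} (hf : IntegrableOn f s) (hK : Measurable K)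
    (hs : MeasurableSet s) {C : ℝ} (hC : ∀ t ∈ s, |K t| ≤ C) :
    IntegrableOn (fun t => K t * f t) s :=
  Integrable.bdd_mul (c := C) hf hK.aestronglyMeasurable
    (by rw [ae_restrict_iff' hs]; exact Eventually.of_forall hC)

/-- The common source of Fatou's theorem and of the comparison with truncated cotangent integrals:
only the size of the kernel matters once `f θ` is subtracted. -/
lemma tendsto_integral_of_kernel_bound {f : ℝ → ℝ} {θ : ℝ}
    (hf : IntegrableOn f (Icc (-Real.pi) Real.pi)) (hθ : IsLebesguePoint f θ)
    {K : ℝ → ℝ → ℝ} {C : ℝ}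
    (hK : ∀ᶠ δ in 𝓝[>] (0 : ℝ), ∀ t ∈ Icc (-Real.pi) Real.pi,
      |K δ t| ≤ C * (δ / (δ ^ 2 + (t - θ) ^ 2))) :
    Tendsto (fun δ => ∫ t in Icc (-Real.pi) Real.pi, K δ t * (f t - f θ)) (𝓝[>] 0) (𝓝 0) := by
  set S := Icc (-Real.pi) Real.pi with hS
  have hSm : MeasurableSet S := measurableSet_Icc
  have hd : IntegrableOn (fun t => |f t - f θ|) S :=
    (hf.sub (integrableOn_const isCompact_Icc.measure_lt_top.ne)).abs
  have hφ : Integrable (S.indicator fun t => |f t - f θ|) := hd.integrable_indicator hSm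
  have hφ0 : ∀ t, 0 ≤ S.indicator (fun t => |f t - f θ|) t :=
    indicator_nonneg (fun _ _ => abs_nonneg _)
  have h1 := (tendsto_integral_kernel hφ hφ0 θ hθ).const_mul C
  rw [mul_zero] at h1
  refine squeeze_zero_norm' ?_ h1
  filter_upwards [hK, self_mem_nhdsWithin] with δ hδ hpos
  have hpos : 0 < δ := hpos
  have heq : C * ∫ t, δ / (δ ^ 2 + (t - θ) ^ 2) * S.indicator (fun t => |f t - f θ|) t =
      ∫ t in S, C * (δ / (δ ^ 2 + (t - θ) ^ 2) * |f t - f θ|) := by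
    rw [← integral_const_mul, ← integral_indicator hSm]
    congr 1
    ext t
    by_cases ht : t ∈ S <;> simp [ht]
  rw [heq]
  refine norm_integral_le_of_norm_le ?_ ?_
  · refine Integrable.const_mul (integrableOn_bdd_mul (C := 1 / δ) hd (by fun_prop) hSm ?_) C
    intro t _
    rw [abs_of_nonneg (by positivity), div_le_div_iff₀ (by positivity) hpos]
    nlinarith [sq_nonneg (t - θ)]
  · rw [ae_restrict_iff' hSm]
    refine Eventually.of_forall fun t ht => ?_
    rw [norm_mul, Real.norm_eq_abs, Real.norm_eq_abs, ← mul_assoc]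
    exact mul_le_mul_of_nonneg_right (hδ t ht) (abs_nonneg _)

/-! ### The Herglotz–Schwarz integral and analyticity. -/

lemma norm_rotation (t : ℝ) : ‖Complex.exp (-(Complex.I * (t : ℂ)))‖ = 1 := by
  rw [Complex.norm_exp]; simp

lemma rotation_pow (k : ℕ) (t : ℝ) : Complex.exp (-(Complex.I * (t : ℂ))) ^ k =
    (Real.cos (k * t) : ℂ) - Complex.I * (Real.sin (k * t) : ℂ) := by
  rw [← Complex.exp_nat_mul]
  have : (k : ℂ) * -(Complex.I * (t : ℂ)) = (-(k * t : ℝ) : ℝ) * Complex.I := by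
    push_cast; ring
  rw [this, Complex.exp_mul_I, ← Complex.ofReal_cos, ← Complex.ofReal_sin, Real.cos_neg,
    Real.sin_neg]
  push_cast; ring

lemma integrableOn_continuous_mul {K : ℝ → ℂ} (hK : Continuous K) {f : ℝ → ℝ}
    (hf : IntegrableOn f (Icc (-Real.pi) Real.pi)) :
    IntegrableOn (fun t => K t * (f t : ℂ)) (Icc (-Real.pi) Real.pi) :=
  IntegrableOn.continuousOn_mul hK.continuousOn hf.ofReal isCompact_Icc

lemma integral_eq_integral_Icc {E : Type*} [NormedAddCommGroup E] [NormedSpace ℝ E]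
    (F : ℝ → E) : ∫ t in (-Real.pi)..Real.pi, F t = ∫ t in Icc (-Real.pi) Real.pi, F t := by
  rw [intervalIntegral.integral_of_le (by linarith [Real.pi_pos]), integral_Icc_eq_integral_Ioc]

/-- The coefficients of `(1 + q) / (1 - q)`. -/
noncomputable def herglotzCoeff (k : ℕ) : ℂ := if k = 0 then 1 else 2

lemma norm_herglotzCoeff_le (k : ℕ) : ‖herglotzCoeff k‖ ≤ 2 := by
  unfold herglotzCoeff; split_ifs <;> simp

lemma hasSum_herglotz {q : ℂ} (hq : ‖q‖ < 1) :
    HasSum (fun k => herglotzCoeff k * q ^ k) ((1 + q) / (1 - q)) := by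
  have h1 : HasSum (fun k => 2 * q ^ k) (2 * (1 - q)⁻¹) :=
    (hasSum_geometric_of_norm_lt_one hq).mul_left 2
  have h2 : HasSum (fun k : ℕ => if k = 0 then (1 : ℂ) else 0) 1 := hasSum_ite_eq 0 1
  have hne : 1 - q ≠ 0 := by
    intro h
    rw [sub_eq_zero] at h
    rw [← h] at hq
    simp at hq
  have e1 : (fun k => herglotzCoeff k * q ^ k) =
      fun k => 2 * q ^ k - if k = 0 then (1 : ℂ) else 0 := by
    ext k
    unfold herglotzCoeff
    split_ifs with hk
    · simp [hk]; norm_num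
    · simp
  have e2 : (1 + q) / (1 - q) = 2 * (1 - q)⁻¹ - 1 := by
    field_simp
    ring
  rw [e1, e2]
  exact h1.sub h2

/-- The halved constant term of `taylorCoeff` is exactly what makes the coefficients those of `(1 +
q) / (1 - q)`. -/
lemma taylorCoeff_eq_integral {f : ℝ → ℝ} (hf : IntegrableOn f (Icc (-Real.pi) Real.pi)) (k : ℕ) :
    taylorCoeff f k = ∫ t in Icc (-Real.pi) Real.pi, (2 * Real.pi : ℂ)⁻¹ * (herglotzCoeff k *
      Complex.exp (-(Complex.I * (t : ℂ))) ^ k * (f t : ℂ)) := by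
  have hpi : (Real.pi : ℂ) ≠ 0 := by exact_mod_cast Real.pi_ne_zero
  have hc : IntegrableOn (fun t => (Real.cos (k * t) : ℂ) * (f t : ℂ))
    (Icc (-Real.pi) Real.pi) := integrableOn_continuous_mul (by fun_prop) hf
  have hs : IntegrableOn (fun t => Complex.I * ((Real.sin (k * t) : ℂ) * (f t : ℂ)))
    (Icc (-Real.pi) Real.pi) := (integrableOn_continuous_mul (by fun_prop) hf).const_mul _
  have hmain : ∫ t in Icc (-Real.pi) Real.pi, Complex.exp (-(Complex.I * (t : ℂ))) ^ k * (f t : ℂ)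
      = Real.pi * ((fourierCos f k : ℂ) - Complex.I * (fourierSin f k : ℂ)) := by
    simp_rw [rotation_pow, sub_mul, mul_assoc]
    rw [integral_sub hc hs, integral_const_mul, fourierCos, fourierSin, integral_eq_integral_Icc,
      integral_eq_integral_Icc]
    simp_rw [← Complex.ofReal_mul]
    rw [integral_complex_ofReal, integral_complex_ofReal]
    push_cast
    field_simp
  simp_rw [mul_assoc (herglotzCoeff k)]
  rw [integral_const_mul, integral_const_mul, hmain, taylorCoeff, herglotzCoeff]
  have h0 : fourierSin f 0 = 0 := by simp [fourierSin]
  split_ifs with hk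
  · subst hk
    rw [h0]
    field_simp
    simp
  · field_simp

lemma norm_lt_one_rotation {z : ℂ} (hz : ‖z‖ < 1) (t : ℝ) :
    ‖z * Complex.exp (-(Complex.I * (t : ℂ)))‖ < 1 := by
  rwa [norm_mul, norm_rotation, mul_one]

/-- The Herglotz–Schwarz representation of the inner analytic function. -/
theorem hasSum_innerAnalytic {f : ℝ → ℝ} (hf : IntegrableOn f (Icc (-Real.pi) Real.pi))
    {z : ℂ} (hz : ‖z‖ < 1) :
    HasSum (fun k => taylorCoeff f k * z ^ k)
      (∫ t in Icc (-Real.pi) Real.pi, (2 * Real.pi : ℂ)⁻¹ *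
        ((1 + z * Complex.exp (-(Complex.I * (t : ℂ)))) /
          (1 - z * Complex.exp (-(Complex.I * (t : ℂ)))) * (f t : ℂ))) := by
  set F : ℕ → ℝ → ℂ := fun k t => (2 * Real.pi : ℂ)⁻¹ * (herglotzCoeff k *
    (z * Complex.exp (-(Complex.I * (t : ℂ)))) ^ k * (f t : ℂ)) with hF
  have hFi : ∀ k, Integrable (F k) (volume.restrict (Icc (-Real.pi) Real.pi)) := fun k =>
    (integrableOn_continuous_mul (by fun_prop) hf).const_mul _
  have hn : ∀ k t, ‖F k t‖ = ‖(2 * Real.pi : ℂ)⁻¹‖ * ‖herglotzCoeff k‖ * ‖z‖ ^ k * |f t| := by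
    intro k t
    simp only [hF, norm_mul, norm_pow, norm_rotation, mul_one, Complex.norm_real,
      Real.norm_eq_abs]
    ring
  have hsum : Summable fun k => ∫ t in Icc (-Real.pi) Real.pi, ‖F k t‖ := by
    simp_rw [hn, integral_const_mul]
    apply Summable.mul_right
    refine Summable.of_nonneg_of_le (fun k => by positivity) (fun k => ?_)
      ((summable_geometric_of_lt_one (norm_nonneg z) hz).mul_left (‖(2 * Real.pi : ℂ)⁻¹‖ * 2))
    have := norm_herglotzCoeff_le k
    gcongr
  have h := hasSum_integral_of_summable_integral_norm hFi hsum
  have e1 : (fun k => taylorCoeff f k * z ^ k) =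
      fun k => ∫ t in Icc (-Real.pi) Real.pi, F k t := by
    ext k
    rw [taylorCoeff_eq_integral hf, ← integral_mul_const]
    congr 1
    ext t
    simp only [hF]
    ring
  rw [e1]
  have e2 : ∀ t, ∑' k, F k t = (2 * Real.pi : ℂ)⁻¹ *
        ((1 + z * Complex.exp (-(Complex.I * (t : ℂ)))) /
          (1 - z * Complex.exp (-(Complex.I * (t : ℂ)))) * (f t : ℂ)) := fun t =>
    (((hasSum_herglotz (norm_lt_one_rotation hz t)).mul_right (f t : ℂ)).mul_left
      (2 * Real.pi : ℂ)⁻¹).tsum_eq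
  simp_rw [e2] at h
  exact h

lemma innerAnalytic_eq_integral {f : ℝ → ℝ} (hf : IntegrableOn f (Icc (-Real.pi) Real.pi))
    {z : ℂ} (hz : ‖z‖ < 1) :
    innerAnalytic f z = ∫ t in Icc (-Real.pi) Real.pi, (2 * Real.pi : ℂ)⁻¹ *
        ((1 + z * Complex.exp (-(Complex.I * (t : ℂ)))) /
          (1 - z * Complex.exp (-(Complex.I * (t : ℂ)))) * (f t : ℂ)) :=
  (hasSum_innerAnalytic hf hz).tsum_eq

lemma continuous_herglotz_kernel {z : ℂ} (hz : ‖z‖ < 1) :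
    Continuous fun t : ℝ => (1 + z * Complex.exp (-(Complex.I * (t : ℂ)))) /
          (1 - z * Complex.exp (-(Complex.I * (t : ℂ)))) := by
  refine Continuous.div (by fun_prop) (by fun_prop) fun t h => ?_
  have := norm_lt_one_rotation hz t
  rw [sub_eq_zero] at h
  rw [← h] at this
  simp at this

lemma integrableOn_herglotz {f : ℝ → ℝ} (hf : IntegrableOn f (Icc (-Real.pi) Real.pi))
    {z : ℂ} (hz : ‖z‖ < 1) :
    IntegrableOn (fun t : ℝ => (2 * Real.pi : ℂ)⁻¹ *
        ((1 + z * Complex.exp (-(Complex.I * (t : ℂ)))) /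
          (1 - z * Complex.exp (-(Complex.I * (t : ℂ)))) * (f t : ℂ)))
      (Icc (-Real.pi) Real.pi) :=
  (integrableOn_continuous_mul (continuous_herglotz_kernel hz) hf).const_mul _

lemma innerAnalytic_sub {f g : ℝ → ℝ} (hf : IntegrableOn f (Icc (-Real.pi) Real.pi))
    (hg : IntegrableOn g (Icc (-Real.pi) Real.pi)) {z : ℂ} (hz : ‖z‖ < 1) :
    innerAnalytic (fun t => f t - g t) z = innerAnalytic f z - innerAnalytic g z := by
  rw [innerAnalytic_eq_integral (f := fun t => f t - g t) (hf.sub hg) hz, innerAnalytic_eq_integral hf hz,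
    innerAnalytic_eq_integral hg hz,
    ← integral_sub (integrableOn_herglotz hf hz) (integrableOn_herglotz hg hz)]
  congr 1
  ext t
  push_cast
  ring

/-- Yields the total integrals of both Poisson kernels without computing them directly. -/
lemma innerAnalytic_const (c : ℝ) {z : ℂ} : innerAnalytic (fun _ => c) z = c := by
  have h0 : taylorCoeff (fun _ => c) 0 = c := by
    rw [taylorCoeff, if_pos rfl, fourierCos]
    simp
    field_simp
    ring
  have hk : ∀ k : ℕ, k ≠ 0 → taylorCoeff (fun _ => c) k = 0 := by
    intro k hk
    have hk' : (k : ℝ) ≠ 0 := by exact_mod_cast hk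
    rw [taylorCoeff, if_neg hk, fourierCos, fourierSin, intervalIntegral.integral_mul_const,
      intervalIntegral.integral_mul_const,
      intervalIntegral.integral_comp_mul_left (fun x => Real.cos x) hk',
      intervalIntegral.integral_comp_mul_left (fun x => Real.sin x) hk']
    simp
  rw [innerAnalytic, tsum_eq_single 0]
  · simp [h0]
  · intro k hk0
    rw [hk k hk0, zero_mul]

lemma norm_taylorCoeff_le {f : ℝ → ℝ} (hf : IntegrableOn f (Icc (-Real.pi) Real.pi)) :
    ∃ C, ∀ k, ‖taylorCoeff f k‖ ≤ C := by
  refine ⟨∫ t in Icc (-Real.pi) Real.pi, ‖(2 * Real.pi : ℂ)⁻¹‖ * (2 * |f t|), fun k => ?_⟩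
  rw [taylorCoeff_eq_integral hf]
  refine norm_integral_le_of_norm_le ((hf.abs.const_mul 2).const_mul _)
    (Eventually.of_forall fun t => ?_)
  simp only [norm_mul, norm_pow, norm_rotation, one_pow, mul_one, Complex.norm_real,
      Real.norm_eq_abs]
  have := norm_herglotzCoeff_le k
  gcongr

lemma hasFPowerSeriesOnBall_innerAnalytic {f : ℝ → ℝ}
    (hf : IntegrableOn f (Icc (-Real.pi) Real.pi)) :
    HasFPowerSeriesOnBall (innerAnalytic f) (FormalMultilinearSeries.ofScalars ℂ (taylorCoeff f))
      0 1 where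
  r_le := by
    obtain ⟨C, hC⟩ := norm_taylorCoeff_le hf
    refine FormalMultilinearSeries.le_radius_of_bound _ (r := 1) C fun n => ?_
    rw [FormalMultilinearSeries.ofScalars_norm]
    simpa using hC n
  r_pos := one_pos
  hasSum {z} hz := by
    have hz' : ‖z‖ < 1 := by
      rw [← ENNReal.ofReal_one, Metric.eball_ofReal] at hz
      simpa using hz
    have h := hasSum_innerAnalytic hf hz'
    rw [← innerAnalytic_eq_integral hf hz'] at h
    simpa [FormalMultilinearSeries.ofScalars_apply_eq, mul_comm] using h

lemma differentiableOn_innerAnalytic {f : ℝ → ℝ}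
    (hf : IntegrableOn f (Icc (-Real.pi) Real.pi)) :
    DifferentiableOn ℂ (innerAnalytic f) (Metric.ball 0 1) := by
  have h := (hasFPowerSeriesOnBall_innerAnalytic hf).differentiableOn
  rwa [← ENNReal.ofReal_one, Metric.eball_ofReal] at h

/-! ### Poisson and conjugate Poisson kernels. -/

/-- The Poisson kernel of the unit disk. -/
noncomputable def poissonKer (r s : ℝ) : ℝ :=
  (1 - r ^ 2) / ((1 - r) ^ 2 + 4 * r * Real.sin (s / 2) ^ 2)

/-- The conjugate Poisson kernel of the unit disk (with the sign for the variable `t - θ`). -/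
noncomputable def conjPoissonKer (r s : ℝ) : ℝ :=
  -(4 * r * Real.sin (s / 2) * Real.cos (s / 2)) / ((1 - r) ^ 2 + 4 * r * Real.sin (s / 2) ^ 2)

lemma poisson_denom_pos {r : ℝ} (hr0 : 0 ≤ r) (hr1 : r < 1) (s : ℝ) :
    0 < (1 - r) ^ 2 + 4 * r * Real.sin (s / 2) ^ 2 := by
  have : 0 < 1 - r := by linarith
  positivity

lemma norm_polar {r : ℝ} (hr0 : 0 ≤ r) (θ : ℝ) :
    ‖(r : ℂ) * Complex.exp (Complex.I * (θ : ℂ))‖ = r := by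
  rw [norm_mul, Complex.norm_exp]
  simp [abs_of_nonneg hr0]

/-- With `q = r * exp(-i(t - θ))`, the denominator of both kernels is `|1 - q|²` written in the half
angle, the form that can be compared with `cot((t - θ)/2)`. -/
lemma herglotz_kernel_eq {r : ℝ} (hr0 : 0 ≤ r) (hr1 : r < 1) (θ t : ℝ) :
    (1 + (r : ℂ) * Complex.exp (Complex.I * (θ : ℂ)) * Complex.exp (-(Complex.I * (t : ℂ)))) /
      (1 - (r : ℂ) * Complex.exp (Complex.I * (θ : ℂ)) * Complex.exp (-(Complex.I * (t : ℂ)))) =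
    (poissonKer r (t - θ) : ℂ) + Complex.I * (conjPoissonKer r (t - θ) : ℂ) := by
  have hq : (r : ℂ) * Complex.exp (Complex.I * (θ : ℂ)) * Complex.exp (-(Complex.I * (t : ℂ))) =
      (r : ℂ) * ((Real.cos ((t - θ) / 2) : ℂ) - Complex.I * (Real.sin ((t - θ) / 2) : ℂ)) ^ 2 := by
    have h2 := rotation_pow 1 ((t - θ) / 2)
    simp only [pow_one, Nat.cast_one, one_mul] at h2
    rw [← h2, mul_assoc, ← Complex.exp_add, ← Complex.exp_nat_mul]
    congr 2
    push_cast
    ring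
  have hne : 1 - (r : ℂ) * Complex.exp (Complex.I * (θ : ℂ)) *
      Complex.exp (-(Complex.I * (t : ℂ))) ≠ 0 := by
    intro h
    have h1 := norm_lt_one_rotation (z := (r : ℂ) * Complex.exp (Complex.I * (θ : ℂ)))
      (by rwa [norm_polar hr0]) t
    rw [← sub_eq_zero.1 h] at h1
    simp at h1
  rw [div_eq_iff hne, hq, poissonKer, conjPoissonKer]
  have hD := (poisson_denom_pos hr0 hr1 (t - θ)).ne'
  have hcs := Real.sin_sq_add_cos_sq ((t - θ) / 2)
  set S := Real.sin ((t - θ) / 2)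
  set C := Real.cos ((t - θ) / 2)
  have hC : C ^ 2 = 1 - S ^ 2 := by linarith
  have hD' : ((1 - r : ℂ) ^ 2 + 4 * r * S ^ 2) ≠ 0 := by exact_mod_cast hD
  have hC' : (C : ℂ) ^ 2 = 1 - (S : ℂ) ^ 2 := by exact_mod_cast hC
  push_cast
  rw [← mul_div_assoc, ← add_div, div_mul_eq_mul_div, eq_div_iff hD']
  have hI : Complex.I ^ 2 = -1 := Complex.I_sq
  have hI3 : Complex.I ^ 3 = -Complex.I := by rw [pow_succ, hI]; ring
  ring_nf
  simp only [hI, hI3]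
  ring_nf
  -- Cubes need a rule of their own: the rewrite for `C ^ 2` does not match inside the normalised `C
  -- ^ 3`.
  have hC3 : (C : ℂ) ^ 3 = C * (1 - (S : ℂ) ^ 2) := by rw [pow_succ, hC']; ring
  simp only [hC', hC3]
  ring

lemma continuous_poissonKer {r : ℝ} (hr0 : 0 ≤ r) (hr1 : r < 1) : Continuous (poissonKer r) := by
  unfold poissonKer
  exact Continuous.div (by fun_prop) (by fun_prop) fun s => (poisson_denom_pos hr0 hr1 s).ne'

lemma continuous_conjPoissonKer {r : ℝ} (hr0 : 0 ≤ r) (hr1 : r < 1) :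
    Continuous (conjPoissonKer r) := by
  unfold conjPoissonKer
  exact Continuous.div (by fun_prop) (by fun_prop) fun s => (poisson_denom_pos hr0 hr1 s).ne'

lemma integrableOn_continuous_mul_real {K : ℝ → ℝ} (hK : Continuous K) {f : ℝ → ℝ}
    (hf : IntegrableOn f (Icc (-Real.pi) Real.pi)) :
    IntegrableOn (fun t => K t * f t) (Icc (-Real.pi) Real.pi) :=
  IntegrableOn.continuousOn_mul hK.continuousOn hf isCompact_Icc

lemma integrableOn_poissonKer_mul {f : ℝ → ℝ} (hf : IntegrableOn f (Icc (-Real.pi) Real.pi))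
    {r : ℝ} (hr0 : 0 ≤ r) (hr1 : r < 1) (θ : ℝ) :
    IntegrableOn (fun t => poissonKer r (t - θ) * f t) (Icc (-Real.pi) Real.pi) :=
  integrableOn_continuous_mul_real
    ((continuous_poissonKer hr0 hr1).comp (continuous_id.sub continuous_const)) hf

lemma integrableOn_conjPoissonKer_mul {f : ℝ → ℝ} (hf : IntegrableOn f (Icc (-Real.pi) Real.pi))
    {r : ℝ} (hr0 : 0 ≤ r) (hr1 : r < 1) (θ : ℝ) :
    IntegrableOn (fun t => conjPoissonKer r (t - θ) * f t) (Icc (-Real.pi) Real.pi) :=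
  integrableOn_continuous_mul_real
    ((continuous_conjPoissonKer hr0 hr1).comp (continuous_id.sub continuous_const)) hf

lemma innerAnalytic_polar {f : ℝ → ℝ} (hf : IntegrableOn f (Icc (-Real.pi) Real.pi))
    {r : ℝ} (hr0 : 0 ≤ r) (hr1 : r < 1) (θ : ℝ) :
    innerAnalytic f ((r : ℂ) * Complex.exp (Complex.I * (θ : ℂ))) =
      (((2 * Real.pi)⁻¹ * ∫ t in Icc (-Real.pi) Real.pi, poissonKer r (t - θ) * f t : ℝ) : ℂ) +
      Complex.I *
      (((2 * Real.pi)⁻¹ * ∫ t in Icc (-Real.pi) Real.pi, conjPoissonKer r (t - θ) * f t : ℝ) : ℂ)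
      := by
  rw [innerAnalytic_eq_integral hf (by rwa [norm_polar hr0])]
  simp_rw [herglotz_kernel_eq hr0 hr1, add_mul]
  rw [integral_const_mul, integral_add]
  · simp_rw [mul_assoc Complex.I, ← Complex.ofReal_mul]
    rw [integral_const_mul, integral_complex_ofReal, integral_complex_ofReal]
    push_cast
    ring
  · simp_rw [← Complex.ofReal_mul]
    exact (integrableOn_poissonKer_mul hf hr0 hr1 θ).ofReal
  · simp_rw [mul_assoc Complex.I, ← Complex.ofReal_mul]
    exact (integrableOn_conjPoissonKer_mul hf hr0 hr1 θ).ofReal.const_mul _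

lemma re_innerAnalytic_polar {f : ℝ → ℝ} (hf : IntegrableOn f (Icc (-Real.pi) Real.pi))
    {r : ℝ} (hr0 : 0 ≤ r) (hr1 : r < 1) (θ : ℝ) :
    (innerAnalytic f ((r : ℂ) * Complex.exp (Complex.I * (θ : ℂ)))).re =
      (2 * Real.pi)⁻¹ * ∫ t in Icc (-Real.pi) Real.pi, poissonKer r (t - θ) * f t := by
  rw [innerAnalytic_polar hf hr0 hr1, Complex.add_re, Complex.ofReal_re, Complex.I_mul_re,
    Complex.ofReal_im, neg_zero, add_zero]

lemma im_innerAnalytic_polar {f : ℝ → ℝ} (hf : IntegrableOn f (Icc (-Real.pi) Real.pi))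
    {r : ℝ} (hr0 : 0 ≤ r) (hr1 : r < 1) (θ : ℝ) :
    (innerAnalytic f ((r : ℂ) * Complex.exp (Complex.I * (θ : ℂ)))).im =
      (2 * Real.pi)⁻¹ * ∫ t in Icc (-Real.pi) Real.pi, conjPoissonKer r (t - θ) * f t := by
  rw [innerAnalytic_polar hf hr0 hr1, Complex.add_im, Complex.ofReal_im, Complex.I_mul_im,
    Complex.ofReal_re, zero_add]

lemma integrableOn_const_Icc (c : ℝ) :
    IntegrableOn (fun _ : ℝ => c) (Icc (-Real.pi) Real.pi) :=
  integrableOn_const isCompact_Icc.measure_lt_top.ne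

lemma integral_poissonKer_mul_const {r : ℝ} (hr0 : 0 ≤ r) (hr1 : r < 1) (θ c : ℝ) :
    ∫ t in Icc (-Real.pi) Real.pi, poissonKer r (t - θ) * c = 2 * Real.pi * c := by
  have h := re_innerAnalytic_polar (integrableOn_const_Icc c) hr0 hr1 θ
  rw [innerAnalytic_const, Complex.ofReal_re] at h
  have h2 : ∀ x : ℝ, x = 2 * Real.pi * ((2 * Real.pi)⁻¹ * x) := fun x => by field_simp
  rw [h2 (∫ t in Icc (-Real.pi) Real.pi, poissonKer r (t - θ) * c), ← h]

lemma integral_conjPoissonKer_mul_const {r : ℝ} (hr0 : 0 ≤ r) (hr1 : r < 1) (θ c : ℝ) :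
    ∫ t in Icc (-Real.pi) Real.pi, conjPoissonKer r (t - θ) * c = 0 := by
  have h := im_innerAnalytic_polar (integrableOn_const_Icc c) hr0 hr1 θ
  rw [innerAnalytic_const, Complex.ofReal_im] at h
  have : (2 * Real.pi)⁻¹ ≠ 0 := by positivity
  exact (mul_eq_zero.1 h.symm).resolve_left this

lemma re_innerAnalytic_nonneg {f : ℝ → ℝ} (hf : IntegrableOn f (Icc (-Real.pi) Real.pi))
    (hf0 : ∀ t, 0 ≤ f t) {z : ℂ} (hz : ‖z‖ < 1) : 0 ≤ (innerAnalytic f z).re := by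
  have hz' : z = (‖z‖ : ℂ) * Complex.exp (Complex.I * (z.arg : ℂ)) := by
    rw [mul_comm Complex.I]; exact (Complex.norm_mul_exp_arg_mul_I z).symm
  rw [hz', re_innerAnalytic_polar hf (norm_nonneg z) hz]
  refine mul_nonneg (by positivity) (integral_nonneg fun t => mul_nonneg ?_ (hf0 t))
  refine div_nonneg ?_ (poisson_denom_pos (norm_nonneg z) hz _).le
  nlinarith [norm_nonneg z]

/-! ### Kernel bounds and Fatou's theorem. -/

/-- For interior `θ` the half angle stays strictly inside `(-π, π)`, where `sinc` is positive, so
compactness gives a positive minimum. The constant depends on `θ`: at an endpoint the sine also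
vanishes at the opposite endpoint. -/
lemma exists_le_abs_sin_half {θ : ℝ} (hθ : θ ∈ Ioo (-Real.pi) Real.pi) :
    ∃ c > 0, ∀ t ∈ Icc (-Real.pi) Real.pi, c * |t - θ| ≤ |Real.sin ((t - θ) / 2)| := by
  obtain ⟨t₀, ht₀, hmin⟩ := (isCompact_Icc (a := -Real.pi) (b := Real.pi)).exists_isMinOn
    (nonempty_Icc.2 (by linarith [Real.pi_pos]))
    (f := fun t => Real.sinc ((t - θ) / 2))
    (Real.continuous_sinc.comp (by fun_prop)).continuousOn
  have hpos : ∀ x : ℝ, |x| < Real.pi → 0 < Real.sinc x := by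
    intro x hx
    rcases eq_or_ne x 0 with rfl | hne
    · simp
    · rw [Real.sinc_of_ne_zero hne]
      rcases lt_or_gt_of_ne hne with h | h
      · exact div_pos_of_neg_of_neg (Real.sin_neg_of_neg_of_neg_pi_lt h (abs_lt.1 hx).1) h
      · exact div_pos (Real.sin_pos_of_pos_of_lt_pi h (abs_lt.1 hx).2) h
  refine ⟨Real.sinc ((t₀ - θ) / 2) / 2, half_pos (hpos _ ?_), fun t ht => ?_⟩
  · rw [abs_lt]
    constructor <;> linarith [ht₀.1, ht₀.2, hθ.1, hθ.2]
  · have h1 : Real.sinc ((t₀ - θ) / 2) ≤ Real.sinc ((t - θ) / 2) := hmin ht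
    rcases eq_or_ne t θ with rfl | hne
    · simp
    · have hne' : (t - θ) / 2 ≠ 0 := div_ne_zero (sub_ne_zero.2 hne) two_ne_zero
      have h2 : Real.sin ((t - θ) / 2) = Real.sinc ((t - θ) / 2) * ((t - θ) / 2) := by
        rw [Real.sinc_of_ne_zero hne']; field_simp
      have h3 : |Real.sin ((t - θ) / 2)| = |Real.sinc ((t - θ) / 2)| * (|t - θ| / 2) := by
        rw [h2, abs_mul, abs_div, abs_two]
      rw [h3]
      have := le_abs_self (Real.sinc ((t - θ) / 2))
      nlinarith [abs_nonneg (t - θ)]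

/-- The numerator is at most `2 * δ`, and `δ ≤ 1 / 2` keeps the denominator above `δ ^ 2 + 2 * c ^ 2
* s ^ 2`. -/
lemma abs_poissonKer_le {c δ s : ℝ} (hc : 0 < c) (hδ : 0 < δ) (hδ1 : δ ≤ 1 / 2)
    (hs : c * |s| ≤ |Real.sin (s / 2)|) :
    |poissonKer (1 - δ) s| ≤ (2 + 1 / c ^ 2) * (δ / (δ ^ 2 + s ^ 2)) := by
  have hsq : c ^ 2 * s ^ 2 ≤ Real.sin (s / 2) ^ 2 := by
    rw [← sq_abs s, ← sq_abs (Real.sin _), ← mul_pow]; gcongr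
  have hD := poisson_denom_pos (r := 1 - δ) (by linarith) (by linarith) s
  rw [poissonKer, abs_div, abs_of_pos hD, ← mul_div_assoc, abs_of_nonneg (by nlinarith),
    div_le_div_iff₀ hD (by positivity)]
  have h1 : δ ^ 2 + 2 * (c ^ 2 * s ^ 2) ≤
      (1 - (1 - δ)) ^ 2 + 4 * (1 - δ) * Real.sin (s / 2) ^ 2 := by
    nlinarith [mul_nonneg (sq_nonneg c) (sq_nonneg s)]
  have h2 : 2 * (δ ^ 2 + s ^ 2) ≤ (2 + 1 / c ^ 2) * (δ ^ 2 + 2 * (c ^ 2 * s ^ 2)) := by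
    have : (2 + 1 / c ^ 2) * (δ ^ 2 + 2 * (c ^ 2 * s ^ 2)) =
      2 * δ ^ 2 + 4 * c ^ 2 * s ^ 2 + δ ^ 2 / c ^ 2 + 2 * s ^ 2 := by field_simp; ring
    rw [this]
    have h3 : 0 ≤ 4 * c ^ 2 * s ^ 2 := by positivity
    have h4 : 0 ≤ δ ^ 2 / c ^ 2 := by positivity
    linarith
  calc (1 - (1 - δ) ^ 2) * (δ ^ 2 + s ^ 2) ≤ (2 * δ) * (δ ^ 2 + s ^ 2) := by
        gcongr; nlinarith
    _ = δ * (2 * (δ ^ 2 + s ^ 2)) := by ring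
    _ ≤ δ * ((2 + 1 / c ^ 2) * ((1 - (1 - δ)) ^ 2 + 4 * (1 - δ) * Real.sin (s / 2) ^ 2)) := by
        exact mul_le_mul_of_nonneg_left
          (h2.trans (mul_le_mul_of_nonneg_left h1 (by positivity))) hδ.le
    _ = _ := by ring

lemma tendsto_one_sub_nhdsGT : Tendsto (fun δ : ℝ => 1 - δ) (𝓝[>] 0) (𝓝[<] 1) := by
  refine tendsto_nhdsWithin_iff.2 ⟨?_, ?_⟩
  · have : Tendsto (fun δ : ℝ => 1 - δ) (𝓝 0) (𝓝 (1 - 0)) :=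
      (continuous_const.sub continuous_id).tendsto 0
    rw [sub_zero] at this
    exact this.mono_left nhdsWithin_le_nhds
  · filter_upwards [self_mem_nhdsWithin] with δ hδ
    have : 0 < δ := hδ
    exact sub_lt_self 1 this

lemma tendsto_one_sub_nhdsLT : Tendsto (fun ρ : ℝ => 1 - ρ) (𝓝[<] 1) (𝓝[>] 0) := by
  refine tendsto_nhdsWithin_iff.2 ⟨?_, ?_⟩
  · have : Tendsto (fun δ : ℝ => 1 - δ) (𝓝 1) (𝓝 (1 - 1)) :=
      (continuous_const.sub continuous_id).tendsto 1
    rw [sub_self] at this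
    exact this.mono_left nhdsWithin_le_nhds
  · filter_upwards [self_mem_nhdsWithin] with δ hδ
    have : δ < 1 := hδ
    exact sub_pos.2 this

lemma eventually_mem_Ioc_nhdsGT {a : ℝ} (ha : 0 < a) : ∀ᶠ δ in 𝓝[>] (0 : ℝ), δ ∈ Ioc 0 a :=
  Ioc_mem_nhdsGT ha

/-- Fatou's theorem: the radial limit of the Poisson integral at a Lebesgue point. -/
theorem tendsto_re_innerAnalytic {f : ℝ → ℝ} {θ : ℝ}
    (hf : IntegrableOn f (Icc (-Real.pi) Real.pi)) (hθ : IsLebesguePoint f θ)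
    (hθI : θ ∈ Ioo (-Real.pi) Real.pi) :
    Tendsto (fun ρ : ℝ => (innerAnalytic f ((ρ : ℂ) * Complex.exp (Complex.I * (θ : ℂ)))).re)
      (𝓝[<] 1) (𝓝 (f θ)) := by
  obtain ⟨c, hc, hcb⟩ := exists_le_abs_sin_half hθI
  have h := tendsto_integral_of_kernel_bound hf hθ (K := fun δ t => poissonKer (1 - δ) (t - θ))
    (C := 2 + 1 / c ^ 2) (by
      filter_upwards [eventually_mem_Ioc_nhdsGT one_half_pos] with δ hδ t ht
      exact abs_poissonKer_le hc hδ.1 hδ.2 (hcb t ht))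
  have h2 : Tendsto (fun δ : ℝ => (innerAnalytic f (((1 - δ : ℝ) : ℂ) *
      Complex.exp (Complex.I * (θ : ℂ)))).re) (𝓝[>] 0) (𝓝 (f θ)) := by
    have h3 := (h.const_mul (2 * Real.pi)⁻¹).add_const (f θ)
    rw [mul_zero, zero_add] at h3
    refine h3.congr' ?_
    filter_upwards [eventually_mem_Ioc_nhdsGT one_half_pos] with δ hδ
    have hr0 : 0 ≤ 1 - δ := by linarith [hδ.2]
    have hr1 : 1 - δ < 1 := by linarith [hδ.1]
    rw [re_innerAnalytic_polar hf hr0 hr1]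
    simp_rw [mul_sub]
    rw [integral_sub (integrableOn_poissonKer_mul hf hr0 hr1 θ)
      (integrableOn_poissonKer_mul (integrableOn_const_Icc (f θ)) hr0 hr1 θ),
      integral_poissonKer_mul_const hr0 hr1]
    field_simp
    ring
  have h4 := h2.comp tendsto_one_sub_nhdsLT
  refine h4.congr fun ρ => ?_
  simp

/-! ### Truncated cotangent integrals versus conjugate Poisson integrals. -/

/-- Inside the removed interval the kernel is at most `2 / δ`, and there `δ ^ 2 + s ^ 2 ≤ 2 * δ ^
2`. -/
lemma abs_conjPoissonKer_le_of_lt {δ s : ℝ} (hδ : 0 < δ) (hδ1 : δ ≤ 1 / 2) (hs : |s| < δ) :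
    |conjPoissonKer (1 - δ) s| ≤ 4 * (δ / (δ ^ 2 + s ^ 2)) := by
  have hD := poisson_denom_pos (r := 1 - δ) (by linarith) (by linarith) s
  have hS : |Real.sin (s / 2)| ≤ |s| / 2 := by
    have := Real.abs_sin_le_abs (x := s / 2)
    rwa [abs_div, abs_two] at this
  have hC := Real.abs_cos_le_one (s / 2)
  have hsq : s ^ 2 ≤ δ ^ 2 := by rw [← sq_abs s]; gcongr
  rw [conjPoissonKer, abs_div, abs_of_pos hD, abs_neg, abs_mul, abs_mul, abs_mul,
    abs_of_nonneg (by linarith : (0 : ℝ) ≤ 1 - δ), abs_of_pos (by norm_num : (0 : ℝ) < 4)]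
  calc 4 * (1 - δ) * |Real.sin (s / 2)| * |Real.cos (s / 2)| /
        ((1 - (1 - δ)) ^ 2 + 4 * (1 - δ) * Real.sin (s / 2) ^ 2)
      ≤ 4 * 1 * (δ / 2) * 1 / δ ^ 2 := by
        gcongr
        · linarith
        · linarith
        · nlinarith [mul_nonneg (by linarith : (0 : ℝ) ≤ 1 - δ) (sq_nonneg (Real.sin (s / 2)))]
    _ = 2 / δ := by field_simp; norm_num
    _ ≤ 4 * (δ / (δ ^ 2 + s ^ 2)) := by
        rw [← mul_div_assoc, div_le_div_iff₀ hδ (by positivity)]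
        nlinarith

/-- Over the common denominator the terms with `4 * (1 - δ)` cancel, leaving `δ ^ 2` times the
cotangent over the Poisson denominator. This is `O(δ ^ 2 / |s| ^ 3)`, and `δ ≤ |s|` turns it into
the kernel. -/
lemma abs_conjPoissonKer_add_cot_le {c δ s : ℝ} (hc : 0 < c) (hδ : 0 < δ) (hδ1 : δ ≤ 1 / 2)
    (hs : c * |s| ≤ |Real.sin (s / 2)|) (hδs : δ ≤ |s|) :
    |conjPoissonKer (1 - δ) s + Real.cos (s / 2) / Real.sin (s / 2)| ≤
      1 / c ^ 3 * (δ / (δ ^ 2 + s ^ 2)) := by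
  have hD := poisson_denom_pos (r := 1 - δ) (by linarith) (by linarith) s
  have hs0 : 0 < |s| := hδ.trans_le hδs
  have hSpos : 0 < |Real.sin (s / 2)| := lt_of_lt_of_le (by positivity) hs
  have hS0 : Real.sin (s / 2) ≠ 0 := abs_pos.1 hSpos
  have hs1 : s ≠ 0 := abs_pos.1 hs0
  have hC := Real.abs_cos_le_one (s / 2)
  have hid : conjPoissonKer (1 - δ) s + Real.cos (s / 2) / Real.sin (s / 2) =
      Real.cos (s / 2) * δ ^ 2 / (Real.sin (s / 2) *
        ((1 - (1 - δ)) ^ 2 + 4 * (1 - δ) * Real.sin (s / 2) ^ 2)) := by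
    rw [conjPoissonKer]
    have hD' := hD.ne'
    rw [div_add_div _ _ hD' hS0, div_eq_div_iff (mul_ne_zero hD' hS0) (mul_ne_zero hS0 hD')]
    ring
  rw [hid, abs_div, abs_mul, abs_mul, abs_of_pos hD, abs_of_pos (by positivity : 0 < δ ^ 2)]
  calc |Real.cos (s / 2)| * δ ^ 2 / (|Real.sin (s / 2)| *
        ((1 - (1 - δ)) ^ 2 + 4 * (1 - δ) * Real.sin (s / 2) ^ 2))
      ≤ 1 * δ ^ 2 / ((c * |s|) * (2 * (c * |s|) ^ 2)) := by
        gcongr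
        have : (c * |s|) ^ 2 ≤ Real.sin (s / 2) ^ 2 := by
          rw [← sq_abs (Real.sin _)]; gcongr
        nlinarith [sq_nonneg δ]
    _ ≤ 1 / c ^ 3 * (δ / (2 * s ^ 2)) := by
        rw [div_mul_div_comm, div_le_div_iff₀ (by positivity) (by positivity), ← sq_abs s]
        have : 0 ≤ c ^ 3 * δ * |s| ^ 2 * 2 := by positivity
        nlinarith [mul_le_mul_of_nonneg_left hδs this]
    _ ≤ 1 / c ^ 3 * (δ / (δ ^ 2 + s ^ 2)) := by
        have : δ ^ 2 ≤ s ^ 2 := by rw [← sq_abs s]; gcongr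
        gcongr
        linarith

lemma abs_cot_le {c ε s : ℝ} (hc : 0 < c) (hε : 0 < ε) (hs : c * |s| ≤ |Real.sin (s / 2)|)
    (hεs : ε ≤ |s|) : |Real.cos (s / 2) / Real.sin (s / 2)| ≤ 1 / (c * ε) := by
  rw [abs_div]
  have h := Real.abs_cos_le_one (s / 2)
  have : c * ε ≤ |Real.sin (s / 2)| := le_trans (by gcongr) hs
  gcongr

lemma measurableSet_punctured (θ ε : ℝ) : MeasurableSet (punctured θ ε) :=
  measurableSet_Icc.diff measurableSet_Ioo

lemma le_abs_of_mem_punctured {θ ε t : ℝ} (ht : t ∈ punctured θ ε) : ε ≤ |t - θ| := by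
  by_contra! h
  rw [abs_lt] at h
  exact ht.2 ⟨by linarith, by linarith⟩

lemma integrableOn_cotIntegrand {f : ℝ → ℝ} (hf : IntegrableOn f (Icc (-Real.pi) Real.pi))
    {θ : ℝ} (hθI : θ ∈ Ioo (-Real.pi) Real.pi) {ε : ℝ} (hε : 0 < ε) :
    IntegrableOn (cotIntegrand f θ) (punctured θ ε) := by
  obtain ⟨c, hc, hcb⟩ := exists_le_abs_sin_half hθI
  refine integrableOn_bdd_mul (C := 1 / (c * ε)) (hf.mono_set sdiff_subset) (by fun_prop)
    (measurableSet_punctured θ ε) fun t ht => ?_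
  exact abs_cot_le hc hε (hcb t ht.1) (le_abs_of_mem_punctured ht)

/-- `Real.log` depends only on the absolute value, so one antiderivative serves on both sides of the
singularity. -/
lemma integral_cot_interval {θ a b : ℝ} (hab : a ≤ b)
    (h : ∀ t ∈ Icc a b, Real.sin ((t - θ) / 2) ≠ 0) :
    ∫ t in Icc a b, Real.cos ((t - θ) / 2) / Real.sin ((t - θ) / 2) =
      2 * Real.log (Real.sin ((b - θ) / 2)) - 2 * Real.log (Real.sin ((a - θ) / 2)) := by
  rw [integral_Icc_eq_integral_Ioc, ← intervalIntegral.integral_of_le hab]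
  refine intervalIntegral.integral_eq_sub_of_hasDerivAt
    (f := fun t => 2 * Real.log (Real.sin ((t - θ) / 2))) (fun t ht => ?_) ?_
  · rw [uIcc_of_le hab] at ht
    have h1 : HasDerivAt (fun t : ℝ => (t - θ) / 2) (1 / 2) t :=
      ((hasDerivAt_id t).sub_const θ).div_const 2
    have h2 := ((h1.sin).log (h t ht)).const_mul 2
    refine h2.congr_deriv ?_
    field_simp
  · apply ContinuousOn.intervalIntegrable
    rw [uIcc_of_le hab]
    exact ContinuousOn.div (by fun_prop) (by fun_prop) h

/-- The boundary values cancel in pairs: `|sin|` agrees at the two ends of the gap by symmetry, and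
at `±π`, where it equals `|cos(θ/2)|`. -/
lemma integral_cot_punctured {θ δ : ℝ} (hδ : 0 < δ) (h1 : -Real.pi < θ - δ)
    (h2 : θ + δ < Real.pi) :
    ∫ t in punctured θ δ, Real.cos ((t - θ) / 2) / Real.sin ((t - θ) / 2) = 0 := by
  have hθI : θ ∈ Ioo (-Real.pi) Real.pi := ⟨by linarith, by linarith⟩
  have hset : punctured θ δ = Icc (-Real.pi) (θ - δ) ∪ Icc (θ + δ) Real.pi := by
    ext t
    simp only [punctured, Set.mem_sdiff, mem_Icc, mem_Ioo, mem_union, not_and_or, not_lt]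
    constructor
    · rintro ⟨⟨ha, hb⟩, hc | hc⟩
      · exact Or.inl ⟨ha, hc⟩
      · exact Or.inr ⟨hc, hb⟩
    · rintro (⟨ha, hb⟩ | ⟨ha, hb⟩)
      · exact ⟨⟨ha, by linarith⟩, Or.inl hb⟩
      · exact ⟨⟨by linarith, hb⟩, Or.inr ha⟩
  have hint := integrableOn_cotIntegrand (integrableOn_const_Icc 1) hθI hδ
  have hint : IntegrableOn (fun t => Real.cos ((t - θ) / 2) / Real.sin ((t - θ) / 2))
      (punctured θ δ) := by
    unfold cotIntegrand at hint
    simpa using hint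
  obtain ⟨c, hc, hcb⟩ := exists_le_abs_sin_half hθI
  have hne : ∀ t ∈ punctured θ δ, Real.sin ((t - θ) / 2) ≠ 0 := by
    intro t ht
    have := le_abs_of_mem_punctured ht
    exact abs_pos.1 (lt_of_lt_of_le (mul_pos hc (hδ.trans_le this)) (hcb t ht.1))
  rw [hset] at hint hne ⊢
  rw [setIntegral_union _ measurableSet_Icc (hint.mono_set subset_union_left)
    (hint.mono_set subset_union_right), integral_cot_interval h1.le fun t ht => hne t (Or.inl ht),
    integral_cot_interval h2.le fun t ht => hne t (Or.inr ht)]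
  · have e1 : (θ - δ - θ) / 2 = -(δ / 2) := by ring
    have e2 : (θ + δ - θ) / 2 = δ / 2 := by ring
    have e3 : (-Real.pi - θ) / 2 = -(θ / 2 + Real.pi / 2) := by ring
    have e4 : (Real.pi - θ) / 2 = Real.pi / 2 - θ / 2 := by ring
    rw [e1, e2, e3, e4, Real.sin_neg, Real.sin_neg, Real.log_neg_eq_log, Real.log_neg_eq_log,
      Real.sin_add_pi_div_two, Real.sin_pi_div_two_sub]
    ring
  · rw [Set.disjoint_left]
    intro t h3 h4
    linarith [h3.2, h4.1]

/-- At a Lebesgue point, truncated singular integrals and conjugate Poisson integrals are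
equiconvergent. -/
theorem tendsto_im_innerAnalytic_add_truncated {f : ℝ → ℝ} {θ : ℝ}
    (hf : IntegrableOn f (Icc (-Real.pi) Real.pi)) (hθ : IsLebesguePoint f θ)
    (hθI : θ ∈ Ioo (-Real.pi) Real.pi) :
    Tendsto (fun δ : ℝ => 2 * Real.pi * (innerAnalytic f (((1 - δ : ℝ) : ℂ) *
      Complex.exp (Complex.I * (θ : ℂ)))).im + ∫ t in punctured θ δ, cotIntegrand f θ t)
      (𝓝[>] 0) (𝓝 0) := by
  obtain ⟨c, hc, hcb⟩ := exists_le_abs_sin_half hθI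
  have h := tendsto_integral_of_kernel_bound hf hθ (K := fun δ t => conjPoissonKer (1 - δ) (t - θ)
    + (punctured θ δ).indicator (fun t => Real.cos ((t - θ) / 2) / Real.sin ((t - θ) / 2)) t)
    (C := 4 + 1 / c ^ 3) (by
      filter_upwards [eventually_mem_Ioc_nhdsGT one_half_pos] with δ hδ t ht
      have hpos : 0 ≤ δ / (δ ^ 2 + (t - θ) ^ 2) := div_nonneg hδ.1.le (by positivity)
      by_cases htp : t ∈ punctured θ δ
      · rw [indicator_of_mem htp]
        refine (abs_conjPoissonKer_add_cot_le hc hδ.1 hδ.2 (hcb t ht)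
          (le_abs_of_mem_punctured htp)).trans ?_
        gcongr
        linarith
      · rw [indicator_of_notMem htp, add_zero]
        have hlt : |t - θ| < δ := by
          by_contra! hle
          refine htp ⟨ht, fun hI => ?_⟩
          have : |t - θ| < δ := abs_lt.2 ⟨by linarith [hI.1], by linarith [hI.2]⟩
          linarith
        refine (abs_conjPoissonKer_le_of_lt hδ.1 hδ.2 hlt).trans ?_
        gcongr
        have : 0 < 1 / c ^ 3 := by positivity
        linarith)
  refine h.congr' ?_
  -- For small `δ` the gap lies inside `(-π, π)`, as required for the truncated cotangent to
  -- integrate to zero.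
  have hη : 0 < min (Real.pi - θ) (θ + Real.pi) :=
    lt_min (by linarith [hθI.2]) (by linarith [hθI.1])
  filter_upwards [eventually_mem_Ioc_nhdsGT one_half_pos,
    eventually_mem_Ioc_nhdsGT (half_pos hη)] with δ hδ hδ2
  have hr0 : 0 ≤ 1 - δ := by linarith [hδ.2]
  have hr1 : 1 - δ < 1 := by linarith [hδ.1]
  have hd1 : θ + δ < Real.pi := by
    have := min_le_left (Real.pi - θ) (θ + Real.pi); linarith [hδ2.2]
  have hd2 : -Real.pi < θ - δ := by
    have := min_le_right (Real.pi - θ) (θ + Real.pi); linarith [hδ2.2]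
  set F : ℝ → ℝ := fun t => f t - f θ with hFdef
  have hF : IntegrableOn F (Icc (-Real.pi) Real.pi) := hf.sub (integrableOn_const_Icc (f θ))
  have hsub : punctured θ δ ⊆ Icc (-Real.pi) Real.pi := sdiff_subset
  have hcot : ∀ t, (punctured θ δ).indicator
      (fun t => Real.cos ((t - θ) / 2) / Real.sin ((t - θ) / 2)) t * F t =
      (punctured θ δ).indicator (cotIntegrand F θ) t := by
    intro t
    by_cases ht : t ∈ punctured θ δ <;> simp [ht, cotIntegrand]
  have hci := integrableOn_cotIntegrand hF hθI hδ.1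
  have hci1 : IntegrableOn (fun t => Real.cos ((t - θ) / 2) / Real.sin ((t - θ) / 2) * f t)
    (punctured θ δ) := integrableOn_cotIntegrand hf hθI hδ.1
  have hci2 : IntegrableOn (fun t => Real.cos ((t - θ) / 2) / Real.sin ((t - θ) / 2) * f θ)
    (punctured θ δ) := integrableOn_cotIntegrand (integrableOn_const_Icc (f θ)) hθI hδ.1
  simp_rw [add_mul]
  change ∫ t in Icc (-Real.pi) Real.pi, (conjPoissonKer (1 - δ) (t - θ) * F t +
    (punctured θ δ).indicator
      (fun t => Real.cos ((t - θ) / 2) / Real.sin ((t - θ) / 2)) t * F t) = _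
  simp_rw [hcot]
  rw [integral_add (integrableOn_conjPoissonKer_mul hF hr0 hr1 θ)
    ((hci.integrable_indicator (measurableSet_punctured θ δ)).integrableOn),
    setIntegral_indicator (measurableSet_punctured θ δ), inter_eq_self_of_subset_right hsub,
    im_innerAnalytic_polar hf hr0 hr1]
  simp_rw [hFdef, cotIntegrand, mul_sub]
  rw [integral_sub (integrableOn_conjPoissonKer_mul hf hr0 hr1 θ)
      (integrableOn_conjPoissonKer_mul (integrableOn_const_Icc (f θ)) hr0 hr1 θ),
    integral_conjPoissonKer_mul_const hr0 hr1,
    integral_sub hci1 hci2,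
    integral_mul_const, integral_cot_punctured hδ.1 hd2 hd1]
  field_simp
  ring

/-- The principal value exists and equals the conjugate function wherever the latter exists at a
Lebesgue point. -/
theorem hasCauchyPV_of_tendsto {f : ℝ → ℝ} {θ L : ℝ}
    (hf : IntegrableOn f (Icc (-Real.pi) Real.pi)) (hθ : IsLebesguePoint f θ)
    (hθI : θ ∈ Ioo (-Real.pi) Real.pi)
    (hL : Tendsto
      (fun ρ : ℝ => (innerAnalytic f ((ρ : ℂ) * Complex.exp (Complex.I * (θ : ℂ)))).im)
      (𝓝[<] 1) (𝓝 L)) :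
    HasCauchyPV (cotIntegrand f θ) θ (-(2 * Real.pi * L)) := by
  refine ⟨fun ε hε => integrableOn_cotIntegrand hf hθI hε, ?_⟩
  have h := (tendsto_im_innerAnalytic_add_truncated hf hθ hθI).sub
    ((hL.comp tendsto_one_sub_nhdsGT).const_mul (2 * Real.pi))
  rw [zero_sub] at h
  refine h.congr fun δ => ?_
  simp

lemma ae_mem_Ioo : ∀ᵐ θ : ℝ ∂(volume.restrict (Icc (-Real.pi) Real.pi)),
    θ ∈ Ioo (-Real.pi) Real.pi := by
  rw [← Measure.restrict_congr_set Ioo_ae_eq_Icc]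
  exact ae_restrict_mem measurableSet_Ioo

theorem IsFourierConjugate.ae_eq_hilbert {f g : ℝ → ℝ}
    (hf : IntegrableOn f (Icc (-Real.pi) Real.pi)) (hfg : IsFourierConjugate f g) :
    ∀ᵐ θ ∂(volume.restrict (Icc (-Real.pi) Real.pi)),
      HilbertExistsAt f θ ∧ g θ = hilbert f θ := by
  filter_upwards [ae_isLebesguePoint hf, hfg, ae_mem_Ioo] with θ h1 h2 h3
  have h := hasCauchyPV_of_tendsto hf h1 h3 h2
  refine ⟨⟨_, h⟩, ?_⟩
  rw [hilbert, h.cauchyPV_eq]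
  field_simp

/-! ### Taylor coefficients as Fourier coefficients of boundary values. -/

/-- Cauchy's coefficient formula on the circle of radius `r`, moved from `[0, 2π]` to `[-π, π]` by
periodicity. -/
lemma fourier_integral_eq_coeff {G : ℂ → ℂ} {p : FormalMultilinearSeries ℂ ℂ ℂ}
    (hG : DifferentiableOn ℂ G (Metric.ball 0 1)) (hp : HasFPowerSeriesAt G p 0)
    {r : ℝ} (hr0 : 0 < r) (hr1 : r < 1) (k : ℕ) :
    ∫ θ in Icc (-Real.pi) Real.pi, G ((r : ℂ) * Complex.exp (Complex.I * (θ : ℂ))) *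
      Complex.exp (-(Complex.I * (θ : ℂ))) ^ k = 2 * Real.pi * (r : ℂ) ^ k * p.coeff k := by
  lift r to NNReal using hr0.le
  have hq := (hG.mono (Metric.closedBall_subset_ball hr1)).hasFPowerSeriesOnBall
    (by exact_mod_cast hr0)
  rw [hp.eq_formalMultilinearSeries hq.hasFPowerSeriesAt]
  have hr : ((r : ℝ) : ℂ) ≠ 0 := by exact_mod_cast hr0.ne'
  have hpi : (Real.pi : ℂ) ≠ 0 := by exact_mod_cast Real.pi_ne_zero
  have hcoeff : (cauchyPowerSeries G 0 r).coeff k =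
      (cauchyPowerSeries G 0 r) k (fun _ => 1) := rfl
  rw [hcoeff, cauchyPowerSeries_apply, circleIntegral]
  set F : ℝ → ℂ := fun θ => G (((r : ℝ) : ℂ) * Complex.exp (Complex.I * (θ : ℂ))) *
      Complex.exp (-(Complex.I * (θ : ℂ))) ^ k with hF
  have hint : ∀ θ : ℝ, deriv (circleMap 0 r) θ • (fun z => (1 / (z - 0)) ^ k • (z - 0)⁻¹ • G z)
      (circleMap 0 r θ) = Complex.I * ((r : ℂ) ^ k)⁻¹ * F θ := by
    intro θ
    have hne := Complex.exp_ne_zero (Complex.I * (θ : ℂ))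
    simp only [deriv_circleMap, circleMap, zero_add, sub_zero, smul_eq_mul, hF, Complex.exp_neg,
      mul_comm (θ : ℂ) Complex.I, one_div, mul_inv, inv_pow, mul_pow]
    field_simp
  have hper : Function.Periodic F (2 * Real.pi) := by
    intro θ
    have h1 : Complex.I * ((θ + 2 * Real.pi : ℝ) : ℂ) =
        Complex.I * (θ : ℂ) + 2 * Real.pi * Complex.I := by push_cast; ring
    simp only [hF, h1, Complex.exp_neg, Complex.exp_periodic _]
  simp_rw [hint]
  rw [intervalIntegral.integral_const_mul, ← integral_eq_integral_Icc]
  have h := hper.intervalIntegral_add_eq 0 (-Real.pi)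
  rw [zero_add, show -Real.pi + 2 * Real.pi = Real.pi by ring] at h
  rw [h, smul_eq_mul]
  generalize (∫ x in (-Real.pi)..Real.pi, F x) = J
  have hI := Complex.I_ne_zero
  field_simp

lemma polar_mem_ball {r : ℝ} (hr0 : 0 ≤ r) (hr1 : r < 1) (θ : ℝ) :
    (r : ℂ) * Complex.exp (Complex.I * (θ : ℂ)) ∈ Metric.ball (0 : ℂ) 1 := by
  rwa [mem_ball_zero_iff, norm_polar hr0]

lemma continuous_polar_comp {G : ℂ → ℂ} (hG : DifferentiableOn ℂ G (Metric.ball 0 1))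
    {r : ℝ} (hr0 : 0 ≤ r) (hr1 : r < 1) :
    Continuous fun θ : ℝ => G ((r : ℂ) * Complex.exp (Complex.I * (θ : ℂ))) :=
  hG.continuousOn.comp_continuous (by fun_prop) (polar_mem_ball hr0 hr1)

lemma integral_polar_eq {G : ℂ → ℂ} (hG : DifferentiableOn ℂ G (Metric.ball 0 1))
    {r : ℝ} (hr0 : 0 < r) (hr1 : r < 1) :
    ∫ θ in Icc (-Real.pi) Real.pi, G ((r : ℂ) * Complex.exp (Complex.I * (θ : ℂ))) =
      2 * Real.pi * G 0 := by
  obtain ⟨p, hp⟩ := hG.analyticAt (Metric.ball_mem_nhds 0 one_pos)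
  have h := fourier_integral_eq_coeff hG hp hr0 hr1 0
  have h0 : p.coeff 0 = G 0 := hp.coeff_zero _
  simpa [h0] using h

lemma integrableOn_of_continuous {E : Type*} [NormedAddCommGroup E] {F : ℝ → E}
    (hF : Continuous F) : IntegrableOn F (Icc (-Real.pi) Real.pi) :=
  hF.continuousOn.integrableOn_compact isCompact_Icc

/-- A contractive analytic function is close to `1` in `L²` on circles if its value at `0` is. -/
lemma integral_norm_one_sub_sq_le {E : ℂ → ℂ} (hE : DifferentiableOn ℂ E (Metric.ball 0 1))
    (hE1 : ∀ z ∈ Metric.ball (0 : ℂ) 1, ‖E z‖ ≤ 1) {r : ℝ} (hr0 : 0 < r) (hr1 : r < 1) :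
    ∫ θ in Icc (-Real.pi) Real.pi, ‖1 - E ((r : ℂ) * Complex.exp (Complex.I * (θ : ℂ)))‖ ^ 2 ≤
      4 * Real.pi * (1 - (E 0).re) := by
  have hc := continuous_polar_comp hE hr0.le hr1
  have hre : ∫ θ in Icc (-Real.pi) Real.pi,
      (E ((r : ℂ) * Complex.exp (Complex.I * (θ : ℂ)))).re = 2 * Real.pi * (E 0).re := by
    have h : ∫ θ in Icc (-Real.pi) Real.pi,
        (E ((r : ℂ) * Complex.exp (Complex.I * (θ : ℂ)))).re = (∫ θ in Icc (-Real.pi) Real.pi,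
        E ((r : ℂ) * Complex.exp (Complex.I * (θ : ℂ)))).re :=
      integral_re (𝕜 := ℂ) (integrableOn_of_continuous hc)
    rw [h, integral_polar_eq hE hr0 hr1]
    simp
  have hrc : Continuous fun θ : ℝ =>
      2 * (E ((r : ℂ) * Complex.exp (Complex.I * (θ : ℂ)))).re :=
    continuous_const.mul (Complex.continuous_re.comp hc)
  -- Pointwise `|1 - E|² = 1 - 2 Re E + |E|² ≤ 2 - 2 Re E`; the mean value property then evaluates
  -- the integral of `Re E`.
  calc ∫ θ in Icc (-Real.pi) Real.pi, ‖1 - E ((r : ℂ) * Complex.exp (Complex.I * (θ : ℂ)))‖ ^ 2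
      ≤ ∫ θ in Icc (-Real.pi) Real.pi,
          (2 - 2 * (E ((r : ℂ) * Complex.exp (Complex.I * (θ : ℂ)))).re) := by
        refine integral_mono (integrableOn_of_continuous ((continuous_const.sub hc).norm.pow 2))
          (integrableOn_of_continuous (continuous_const.sub hrc))
          fun θ => ?_
        have h1 := hE1 _ (polar_mem_ball hr0.le hr1 θ)
        have h2 := pow_le_one₀ (n := 2) (norm_nonneg _) h1
        simp only [Complex.sq_norm, Complex.normSq_apply, Complex.sub_re, Complex.sub_im,
          Complex.one_re, Complex.one_im] at h2 ⊢
        nlinarith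
    _ = 4 * Real.pi * (1 - (E 0).re) := by
        rw [integral_sub (integrableOn_const_Icc 2)
          (integrableOn_of_continuous hrc), integral_const_mul, hre]
        simp only [integral_const, smul_eq_mul, measureReal_restrict_apply_univ,
          Real.volume_real_Icc_of_le (by linarith [Real.pi_pos] : -Real.pi ≤ Real.pi)]
        ring

lemma tendsto_integral_large_part {x : ℝ → ℝ} {μ : Measure ℝ} (hx : Integrable x μ) :
    Tendsto (fun M : ℕ => ∫ θ, {θ | (M : ℝ) < x θ}.indicator x θ ∂μ) atTop (𝓝 0) := by
  -- A strongly measurable representative makes the level sets measurable.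
  obtain ⟨y, hy, hxy⟩ := hx.1
  have hcongr : ∀ M : ℕ, ∫ θ, {θ | (M : ℝ) < x θ}.indicator x θ ∂μ =
      ∫ θ, {θ | (M : ℝ) < y θ}.indicator y θ ∂μ := by
    intro M
    apply integral_congr_ae
    filter_upwards [hxy] with θ h
    simp [indicator, h]
  simp_rw [hcongr]
  have h0 : ∫ _, (0 : ℝ) ∂μ = 0 := integral_zero _ _
  rw [← h0]
  refine tendsto_integral_of_dominated_convergence (fun θ => ‖y θ‖) (fun M => ?_)
    (hx.congr hxy).norm (fun M => Eventually.of_forall fun θ => norm_indicator_le_norm_self _ _)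
    (Eventually.of_forall fun θ => ?_)
  · exact (hy.measurable.indicator
      (measurableSet_lt measurable_const hy.measurable)).aestronglyMeasurable
  · obtain ⟨N, hN⟩ := exists_nat_ge (y θ)
    refine tendsto_const_nhds.congr' ?_
    filter_upwards [eventually_ge_atTop N] with M hM
    rw [indicator_of_notMem]
    have : (N : ℝ) ≤ M := by exact_mod_cast hM
    simp only [mem_ofPred_eq, not_lt]
    linarith

/-- Cut `W` at a height `M`. Where `|W| > M` use `|1 - E n| ≤ 2`; elsewhere use `M y ≤ η + M² y² /
(4η)` and the `L²` bound, which depends only on `E n 0`. Hence the estimate is uniform in `r`. The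
choices `ε / 6` and `η = ε / (6π)` give three shares of `ε / 3`. -/
lemma integral_norm_mul_norm_one_sub_small {W : ℝ → ℂ}
    (hW : IntegrableOn W (Icc (-Real.pi) Real.pi)) {E : ℕ → ℂ → ℂ}
    (hE : ∀ n, DifferentiableOn ℂ (E n) (Metric.ball 0 1))
    (hE1 : ∀ n, ∀ z ∈ Metric.ball (0 : ℂ) 1, ‖E n z‖ ≤ 1)
    (hElim : Tendsto (fun n => E n 0) atTop (𝓝 1)) {ε : ℝ} (hε : 0 < ε) :
    ∀ᶠ n in atTop, ∀ r : ℝ, 0 < r → r < 1 →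
      ∫ θ in Icc (-Real.pi) Real.pi,
        ‖W θ‖ * ‖1 - E n ((r : ℂ) * Complex.exp (Complex.I * (θ : ℂ)))‖ ≤ ε := by
  have hpi := Real.pi_pos
  obtain ⟨M, hM⟩ := ((tendsto_integral_large_part hW.norm).eventually
    (gt_mem_nhds (by positivity : 0 < ε / 6))).exists
  set X : ℝ → ℝ := {θ | (M : ℝ) < ‖W θ‖}.indicator (fun θ => ‖W θ‖) with hX
  set η : ℝ := ε / (6 * Real.pi) with hη
  have hηpos : 0 < η := by positivity
  have hre : Tendsto (fun n => (M : ℝ) ^ 2 / (4 * η) * (4 * Real.pi * (1 - (E n 0).re))) atTop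
      (𝓝 0) := by
    have h1 : Tendsto (fun n => (E n 0).re) atTop (𝓝 (1 : ℂ).re) :=
      (Complex.continuous_re.tendsto _).comp hElim
    have h2 := ((h1.const_sub 1).const_mul (4 * Real.pi)).const_mul ((M : ℝ) ^ 2 / (4 * η))
    simpa using h2
  filter_upwards [hre.eventually (gt_mem_nhds (by positivity : 0 < ε / 3))] with n hn r hr0 hr1
  have hc := continuous_polar_comp (hE n) hr0.le hr1
  set y : ℝ → ℝ := fun θ => ‖1 - E n ((r : ℂ) * Complex.exp (Complex.I * (θ : ℂ)))‖ with hy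
  have hyc : Continuous y := (continuous_const.sub hc).norm
  have hy2 : ∀ θ, y θ ≤ 2 := by
    intro θ
    have h1 := hE1 n _ (polar_mem_ball hr0.le hr1 θ)
    have h2 := norm_sub_le 1 (E n ((r : ℂ) * Complex.exp (Complex.I * (θ : ℂ))))
    rw [norm_one] at h2
    simp only [hy]
    linarith
  have hXint : IntegrableOn X (Icc (-Real.pi) Real.pi) := by
    refine Integrable.mono' hW.norm ?_ (Eventually.of_forall fun θ => ?_)
    · have hmeas : NullMeasurableSet {θ | (M : ℝ) < ‖W θ‖}
          (volume.restrict (Icc (-Real.pi) Real.pi)) :=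
        nullMeasurableSet_lt aemeasurable_const hW.norm.1.aemeasurable
      exact hW.norm.1.indicator₀ hmeas
    · refine (norm_indicator_le_norm_self _ _).trans ?_
      simp
  have hbound : ∀ θ, ‖W θ‖ * y θ ≤ 2 * X θ + (η + (M : ℝ) ^ 2 / (4 * η) * y θ ^ 2) := by
    intro θ
    have hy0 : 0 ≤ y θ := norm_nonneg _
    have hsq : (M : ℝ) * y θ ≤ η + (M : ℝ) ^ 2 / (4 * η) * y θ ^ 2 := by
      have : η + (M : ℝ) ^ 2 / (4 * η) * y θ ^ 2 - M * y θ = (2 * η - M * y θ) ^ 2 / (4 * η) := by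
        field_simp; ring
      have h2 : 0 ≤ (2 * η - M * y θ) ^ 2 / (4 * η) := by positivity
      linarith
    by_cases hlt : (M : ℝ) < ‖W θ‖
    · have : X θ = ‖W θ‖ := indicator_of_mem (show θ ∈ {θ | (M : ℝ) < ‖W θ‖} from hlt) _
      rw [this]
      have h3 : 0 ≤ η + (M : ℝ) ^ 2 / (4 * η) * y θ ^ 2 := by positivity
      nlinarith [norm_nonneg (W θ), hy2 θ]
    · have : X θ = 0 := indicator_of_notMem (show θ ∉ {θ | (M : ℝ) < ‖W θ‖} from hlt) _
      rw [this]
      nlinarith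
  have hyi : IntegrableOn (fun θ => (M : ℝ) ^ 2 / (4 * η) * y θ ^ 2) (Icc (-Real.pi) Real.pi) :=
    integrableOn_of_continuous (by fun_prop)
  calc ∫ θ in Icc (-Real.pi) Real.pi, ‖W θ‖ * y θ
      ≤ ∫ θ in Icc (-Real.pi) Real.pi, (2 * X θ + (η + (M : ℝ) ^ 2 / (4 * η) * y θ ^ 2)) :=
        integral_mono_of_nonneg
          (Eventually.of_forall fun θ => mul_nonneg (norm_nonneg _) (norm_nonneg _))
          ((hXint.const_mul 2).add ((integrableOn_const_Icc η).add hyi))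
          (Eventually.of_forall hbound)
    _ = 2 * (∫ θ in Icc (-Real.pi) Real.pi, X θ) + (2 * Real.pi * η +
          (M : ℝ) ^ 2 / (4 * η) * ∫ θ in Icc (-Real.pi) Real.pi, y θ ^ 2) := by
        have hsum : IntegrableOn (fun θ => η + (M : ℝ) ^ 2 / (4 * η) * y θ ^ 2)
          (Icc (-Real.pi) Real.pi) := (integrableOn_const_Icc η).add hyi
        rw [integral_add (hXint.const_mul 2) hsum,
          integral_add (integrableOn_const_Icc η) hyi, integral_const_mul, integral_const_mul]
        simp only [integral_const, smul_eq_mul, measureReal_restrict_apply_univ,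
          Real.volume_real_Icc_of_le (by linarith [Real.pi_pos] : -Real.pi ≤ Real.pi)]
        ring
    _ ≤ 2 * (ε / 6) + (2 * Real.pi * η +
          (M : ℝ) ^ 2 / (4 * η) * (4 * Real.pi * (1 - (E n 0).re))) := by
        have := integral_norm_one_sub_sq_le (hE n) (hE1 n) hr0 hr1
        gcongr
    _ ≤ ε := by
        have : 2 * Real.pi * η = ε / 3 := by rw [hη]; field_simp; norm_num
        linarith

/-- Smirnov's theorem in the form needed here: if `w` has integrable radial limits `W` and there
are contractive analytic multipliers `E n → 1` that make `w` bounded, then the Taylor coefficients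
of `w` are the Fourier coefficients of `W`. -/
theorem integral_boundary_eq_coeff {w : ℂ → ℂ} {p : FormalMultilinearSeries ℂ ℂ ℂ} {W : ℝ → ℂ}
    (hw : DifferentiableOn ℂ w (Metric.ball 0 1)) (hp : HasFPowerSeriesAt w p 0)
    (hW : IntegrableOn W (Icc (-Real.pi) Real.pi))
    (hlim : ∀ᵐ θ : ℝ ∂(volume.restrict (Icc (-Real.pi) Real.pi)),
      Tendsto (fun ρ : ℝ => w ((ρ : ℂ) * Complex.exp (Complex.I * (θ : ℂ)))) (𝓝[<] 1) (𝓝 (W θ)))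
    {E : ℕ → ℂ → ℂ} (hE : ∀ n, DifferentiableOn ℂ (E n) (Metric.ball 0 1))
    (hE1 : ∀ n, ∀ z ∈ Metric.ball (0 : ℂ) 1, ‖E n z‖ ≤ 1)
    (hElim : ∀ z ∈ Metric.ball (0 : ℂ) 1, Tendsto (fun n => E n z) atTop (𝓝 1))
    {B : ℕ → ℝ} (hB : ∀ n, ∀ z ∈ Metric.ball (0 : ℂ) 1, ‖w z * E n z‖ ≤ B n) (k : ℕ) :
    ∫ θ in Icc (-Real.pi) Real.pi, W θ * Complex.exp (-(Complex.I * (θ : ℂ))) ^ k =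
      2 * Real.pi * p.coeff k := by
  have hwE : ∀ n, DifferentiableOn ℂ (fun z => w z * E n z) (Metric.ball 0 1) :=
    fun n => hw.mul (hE n)
  choose q hq using fun n => (hwE n).analyticAt (Metric.ball_mem_nhds (0 : ℂ) one_pos)
  have hcoeff := fun n r hr0 hr1 => fourier_integral_eq_coeff (hwE n) (hq n) (r := r) hr0 hr1 k
  have hWk : IntegrableOn (fun θ : ℝ => W θ * Complex.exp (-(Complex.I * (θ : ℂ))) ^ k)
      (Icc (-Real.pi) Real.pi) :=
    IntegrableOn.mul_continuousOn hW (by fun_prop) isCompact_Icc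
  -- Coefficients can be read on a fixed interior circle, here of radius `1/2`, where `w` is bounded
  -- and dominated convergence applies.
  have hq_lim : Tendsto (fun n => (q n).coeff k) atTop (𝓝 (p.coeff k)) := by
    have h2 : (0 : ℝ) < 1 / 2 := by norm_num
    have h2' : (1 / 2 : ℝ) < 1 := by norm_num
    have hpi : (Real.pi : ℂ) ≠ 0 := by exact_mod_cast Real.pi_ne_zero
    have hwc := continuous_polar_comp hw h2.le h2'
    have hconv : Tendsto (fun n => ∫ θ in Icc (-Real.pi) Real.pi,
        w (((1 / 2 : ℝ) : ℂ) * Complex.exp (Complex.I * (θ : ℂ))) *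
        E n (((1 / 2 : ℝ) : ℂ) * Complex.exp (Complex.I * (θ : ℂ))) *
        Complex.exp (-(Complex.I * (θ : ℂ))) ^ k) atTop
        (𝓝 (∫ θ in Icc (-Real.pi) Real.pi,
          w (((1 / 2 : ℝ) : ℂ) * Complex.exp (Complex.I * (θ : ℂ))) *
          Complex.exp (-(Complex.I * (θ : ℂ))) ^ k)) := by
      refine tendsto_integral_of_dominated_convergence
        (fun θ => ‖w (((1 / 2 : ℝ) : ℂ) * Complex.exp (Complex.I * (θ : ℂ)))‖) (fun n => ?_)
        (integrableOn_of_continuous hwc).norm (fun n => Eventually.of_forall fun θ => ?_)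
        (Eventually.of_forall fun θ => ?_)
      · have := continuous_polar_comp (hE n) h2.le h2'
        exact ((hwc.mul this).mul (by fun_prop)).aestronglyMeasurable
      · rw [norm_mul, norm_mul, norm_pow, norm_rotation, one_pow, mul_one]
        exact mul_le_of_le_one_right (norm_nonneg _) (hE1 n _ (polar_mem_ball h2.le h2' θ))
      · have h := ((hElim _ (polar_mem_ball h2.le h2' θ)).const_mul
          (w (((1 / 2 : ℝ) : ℂ) * Complex.exp (Complex.I * (θ : ℂ))))).mul_const
          (Complex.exp (-(Complex.I * (θ : ℂ))) ^ k)
        rwa [mul_one] at h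
    simp_rw [hcoeff _ _ h2 h2', fourier_integral_eq_coeff hw hp h2 h2' k] at hconv
    have hne : 2 * Real.pi * ((1 / 2 : ℝ) : ℂ) ^ k ≠ 0 := by
      simp [Real.pi_ne_zero]
    have h := hconv.const_mul (2 * Real.pi * ((1 / 2 : ℝ) : ℂ) ^ k)⁻¹
    simpa only [inv_mul_cancel_left₀ hne] using h
  -- The order of limits matters: with `n` fixed, boundedness of `w * E n` lets `r → 1`; the
  -- remaining error `∫ |W| |1 - E n|` is small uniformly in `r`.
  have hest : ∀ ε > 0, ∀ᶠ n in atTop,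
      ‖2 * Real.pi * (q n).coeff k - ∫ θ in Icc (-Real.pi) Real.pi,
        W θ * Complex.exp (-(Complex.I * (θ : ℂ))) ^ k‖ ≤ ε := by
    intro ε hε
    filter_upwards [integral_norm_mul_norm_one_sub_small hW hE hE1
      (hElim 0 (Metric.mem_ball_self one_pos)) hε] with n hn
    have hfirst : Tendsto (fun r : ℝ => ∫ θ in Icc (-Real.pi) Real.pi,
        ‖(w ((r : ℂ) * Complex.exp (Complex.I * (θ : ℂ))) - W θ) *
          E n ((r : ℂ) * Complex.exp (Complex.I * (θ : ℂ)))‖) (𝓝[<] 1) (𝓝 0) := by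
      have h0 : ∫ _ in Icc (-Real.pi) Real.pi, (0 : ℝ) = 0 := integral_zero _ _
      rw [← h0]
      have hr : ∀ᶠ r : ℝ in 𝓝[<] 1, r ∈ Ioo (0 : ℝ) 1 := Ioo_mem_nhdsLT one_pos
      refine tendsto_integral_filter_of_dominated_convergence (fun θ => B n + ‖W θ‖) ?_ ?_
        ((integrableOn_const_Icc (B n)).add hW.norm) ?_
      · filter_upwards [hr] with r hr
        have h1 := continuous_polar_comp hw hr.1.le hr.2
        have h2 := continuous_polar_comp (hE n) hr.1.le hr.2
        exact ((h1.aestronglyMeasurable.sub hW.1).mul h2.aestronglyMeasurable).norm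
      · filter_upwards [hr] with r hr
        refine Eventually.of_forall fun θ => ?_
        have hz := polar_mem_ball hr.1.le hr.2 θ
        rw [norm_norm, sub_mul]
        refine (norm_sub_le _ _).trans (add_le_add (hB n _ hz) ?_)
        rw [norm_mul]
        exact mul_le_of_le_one_right (norm_nonneg _) (hE1 n _ hz)
      · filter_upwards [hlim] with θ hθ
        have h1 : Tendsto (fun r : ℝ => ‖w ((r : ℂ) * Complex.exp (Complex.I * (θ : ℂ))) - W θ‖)
            (𝓝[<] 1) (𝓝 0) := tendsto_iff_norm_sub_tendsto_zero.1 hθ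
        refine squeeze_zero' (Eventually.of_forall fun r => norm_nonneg _) ?_ h1
        filter_upwards [hr] with r hr
        rw [norm_mul]
        exact mul_le_of_le_one_right (norm_nonneg _) (hE1 n _ (polar_mem_ball hr.1.le hr.2 θ))
    have hleft : Tendsto (fun r : ℝ => ‖2 * Real.pi * (r : ℂ) ^ k * (q n).coeff k -
        ∫ θ in Icc (-Real.pi) Real.pi, W θ * Complex.exp (-(Complex.I * (θ : ℂ))) ^ k‖) (𝓝[<] 1)
        (𝓝 ‖2 * Real.pi * (q n).coeff k - ∫ θ in Icc (-Real.pi) Real.pi,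
          W θ * Complex.exp (-(Complex.I * (θ : ℂ))) ^ k‖) := by
      have hc : Continuous (fun r : ℝ => ‖2 * Real.pi * (r : ℂ) ^ k * (q n).coeff k -
        ∫ θ in Icc (-Real.pi) Real.pi, W θ * Complex.exp (-(Complex.I * (θ : ℂ))) ^ k‖) := by
        fun_prop
      have h := (hc.tendsto 1).mono_left (nhdsWithin_le_nhds (s := Iio 1))
      simpa using h
    have hright := hfirst.add_const ε
    rw [zero_add] at hright
    refine le_of_tendsto_of_tendsto hleft hright ?_
    filter_upwards [Ioo_mem_nhdsLT (one_pos (α := ℝ))] with r hr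
    have h1 := continuous_polar_comp hw hr.1.le hr.2
    have h2 := continuous_polar_comp (hE n) hr.1.le hr.2
    have hi1 : IntegrableOn (fun θ : ℝ => w ((r : ℂ) * Complex.exp (Complex.I * (θ : ℂ))) *
        E n ((r : ℂ) * Complex.exp (Complex.I * (θ : ℂ))) *
        Complex.exp (-(Complex.I * (θ : ℂ))) ^ k) (Icc (-Real.pi) Real.pi) :=
      integrableOn_of_continuous ((h1.mul h2).mul (by fun_prop))
    have hi2 : IntegrableOn (fun θ : ℝ =>
        ‖(w ((r : ℂ) * Complex.exp (Complex.I * (θ : ℂ))) - W θ) *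
          E n ((r : ℂ) * Complex.exp (Complex.I * (θ : ℂ)))‖) (Icc (-Real.pi) Real.pi) :=
      (IntegrableOn.mul_continuousOn ((integrableOn_of_continuous h1).sub hW) h2.continuousOn
        isCompact_Icc).norm
    have hi3 : IntegrableOn (fun θ : ℝ =>
        ‖W θ‖ * ‖1 - E n ((r : ℂ) * Complex.exp (Complex.I * (θ : ℂ)))‖)
        (Icc (-Real.pi) Real.pi) :=
      IntegrableOn.mul_continuousOn hW.norm (continuous_const.sub h2).norm.continuousOn
        isCompact_Icc
    rw [← hcoeff n r hr.1 hr.2, ← integral_sub hi1 hWk]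
    refine (norm_integral_le_of_norm_le (hi2.add hi3) (Eventually.of_forall fun θ => ?_)).trans ?_
    · rw [← sub_mul, norm_mul, norm_pow, norm_rotation, one_pow, mul_one]
      simp only [Pi.add_apply]
      -- The splitting used is `w E - W = (w - W) E - W (1 - E)`.
      rw [← norm_mul, ← norm_neg (W θ * _)]
      refine le_trans (le_of_eq ?_) (norm_add_le _ _)
      congr 1
      ring
    · simp only [Pi.add_apply]
      rw [integral_add hi2 hi3]
      gcongr
      exact hn r hr.1 hr.2
  have h1 : Tendsto (fun n => 2 * Real.pi * (q n).coeff k) atTop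
      (𝓝 (∫ θ in Icc (-Real.pi) Real.pi, W θ * Complex.exp (-(Complex.I * (θ : ℂ))) ^ k)) := by
    rw [Metric.tendsto_nhds]
    intro ε hε
    filter_upwards [hest (ε / 2) (half_pos hε)] with n hn
    rw [dist_eq_norm]
    linarith
  exact tendsto_nhds_unique h1 (hq_lim.const_mul _)

/-! ### Bounded multipliers from the positive and negative parts. -/

lemma one_le_norm_one_add_mul {a : ℝ} (ha : 0 ≤ a) {v : ℂ} (hv : 0 ≤ v.re) :
    1 ≤ ‖1 + (a : ℂ) * v‖ := by
  refine le_trans ?_ (Complex.re_le_norm _)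
  simp only [Complex.add_re, Complex.one_re, Complex.re_ofReal_mul]
  nlinarith [mul_nonneg ha hv]

lemma one_add_mul_ne_zero {a : ℝ} (ha : 0 ≤ a) {v : ℂ} (hv : 0 ≤ v.re) :
    1 + (a : ℂ) * v ≠ 0 :=
  norm_pos_iff.1 (one_pos.trans_le (one_le_norm_one_add_mul ha hv))

lemma norm_inv_one_add_mul_le {a : ℝ} (ha : 0 ≤ a) {v : ℂ} (hv : 0 ≤ v.re) :
    ‖(1 + (a : ℂ) * v)⁻¹‖ ≤ 1 := by
  rw [norm_inv]
  exact inv_le_one_of_one_le₀ (one_le_norm_one_add_mul ha hv)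

/-- Since `v / (1 + a v) = (1 - 1 / (1 + a v)) / a`, the contraction bound suffices. -/
lemma norm_mul_inv_one_add_mul_le {a : ℝ} (ha : 0 < a) {v : ℂ} (hv : 0 ≤ v.re) :
    ‖v * (1 + (a : ℂ) * v)⁻¹‖ ≤ 2 / a := by
  have hne := one_add_mul_ne_zero ha.le hv
  have ha' : (a : ℂ) ≠ 0 := by exact_mod_cast ha.ne'
  have h : v * (1 + (a : ℂ) * v)⁻¹ = (a : ℂ)⁻¹ * (1 - (1 + (a : ℂ) * v)⁻¹) := by
    rw [eq_inv_mul_iff_mul_eq₀ ha', eq_sub_iff_add_eq]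
    calc (a : ℂ) * (v * (1 + (a : ℂ) * v)⁻¹) + (1 + (a : ℂ) * v)⁻¹ =
        (1 + (a : ℂ) * v) * (1 + (a : ℂ) * v)⁻¹ := by ring
      _ = 1 := mul_inv_cancel₀ hne
  rw [h, norm_mul, norm_inv, Complex.norm_real, Real.norm_of_nonneg ha.le, div_eq_inv_mul]
  gcongr
  refine (norm_sub_le _ _).trans ?_
  rw [norm_one]
  linarith [norm_inv_one_add_mul_le ha.le hv]

/-- If the conjugate function is integrable, then the Taylor coefficients of the inner analytic
function are the Fourier coefficients of its boundary values. -/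
theorem integral_boundary_eq_taylorCoeff {f g : ℝ → ℝ}
    (hf : IntegrableOn f (Icc (-Real.pi) Real.pi))
    (hg : IntegrableOn g (Icc (-Real.pi) Real.pi))
    (hlim : ∀ᵐ θ : ℝ ∂(volume.restrict (Icc (-Real.pi) Real.pi)),
      Tendsto (fun ρ : ℝ => innerAnalytic f ((ρ : ℂ) * Complex.exp (Complex.I * (θ : ℂ))))
        (𝓝[<] 1) (𝓝 ((f θ : ℂ) + Complex.I * (g θ : ℂ)))) (k : ℕ) :
    ∫ θ in Icc (-Real.pi) Real.pi, ((f θ : ℂ) + Complex.I * (g θ : ℂ)) *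
      Complex.exp (-(Complex.I * (θ : ℂ))) ^ k = 2 * Real.pi * taylorCoeff f k := by
  have hp : IntegrableOn (fun t => max (f t) 0) (Icc (-Real.pi) Real.pi) := hf.pos_part
  have hn : IntegrableOn (fun t => max (-f t) 0) (Icc (-Real.pi) Real.pi) := hf.neg_part
  set w₁ := innerAnalytic fun t => max (f t) 0 with hw₁
  set w₂ := innerAnalytic fun t => max (-f t) 0 with hw₂
  have hdiff : ∀ z ∈ Metric.ball (0 : ℂ) 1, innerAnalytic f z = w₁ z - w₂ z := by
    intro z hz
    rw [mem_ball_zero_iff] at hz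
    rw [hw₁, hw₂, ← innerAnalytic_sub hp hn hz]
    congr 1
    ext t
    exact (max_zero_sub_max_neg_zero_eq_self (f t)).symm
  have h₁ : ∀ z ∈ Metric.ball (0 : ℂ) 1, 0 ≤ (w₁ z).re := fun z hz =>
    re_innerAnalytic_nonneg hp (fun t => le_max_right _ _) (mem_ball_zero_iff.1 hz)
  have h₂ : ∀ z ∈ Metric.ball (0 : ℂ) 1, 0 ≤ (w₂ z).re := fun z hz =>
    re_innerAnalytic_nonneg hn (fun t => le_max_right _ _) (mem_ball_zero_iff.1 hz)
  set a : ℕ → ℝ := fun n => 1 / ((n : ℝ) + 1) with ha_def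
  have ha : ∀ n, 0 < a n := fun n => by positivity
  -- One factor tames each of `w₁` and `w₂`; the other factor is then merely a contraction.
  set E : ℕ → ℂ → ℂ := fun n z => (1 + (a n : ℂ) * w₁ z)⁻¹ * (1 + (a n : ℂ) * w₂ z)⁻¹ with hE_def
  have h := integral_boundary_eq_coeff (E := E) (B := fun n => 2 / a n + 2 / a n)
    (differentiableOn_innerAnalytic hf)
    (hasFPowerSeriesOnBall_innerAnalytic hf).hasFPowerSeriesAt
    (W := fun θ => (f θ : ℂ) + Complex.I * (g θ : ℂ))
    (hf.ofReal.add (hg.ofReal.const_mul Complex.I)) hlim ?_ ?_ ?_ ?_ k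
  · rw [h, FormalMultilinearSeries.coeff_ofScalars]
  · intro n
    refine DifferentiableOn.mul (DifferentiableOn.inv ?_ fun z hz => ?_)
      (DifferentiableOn.inv ?_ fun z hz => ?_)
    · exact ((differentiableOn_innerAnalytic hp).const_mul _).const_add _
    · exact one_add_mul_ne_zero (ha n).le (h₁ z hz)
    · exact ((differentiableOn_innerAnalytic hn).const_mul _).const_add _
    · exact one_add_mul_ne_zero (ha n).le (h₂ z hz)
  · intro n z hz
    simp only [hE_def]
    rw [norm_mul]
    exact mul_le_one₀ (norm_inv_one_add_mul_le (ha n).le (h₁ z hz)) (norm_nonneg _)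
      (norm_inv_one_add_mul_le (ha n).le (h₂ z hz))
  · intro z hz
    have hzero : Tendsto (fun n => (a n : ℂ)) atTop (𝓝 0) :=
      Complex.ofReal_zero ▸ (Complex.continuous_ofReal.tendsto 0).comp
        (tendsto_one_div_add_atTop_nhds_zero_nat (𝕜 := ℝ))
    have hinv : ∀ v : ℂ, Tendsto (fun n => (1 + (a n : ℂ) * v)⁻¹) atTop (𝓝 1) := by
      intro v
      have h1 : Tendsto (fun n => 1 + (a n : ℂ) * v) atTop (𝓝 1) := by
        simpa using (hzero.mul_const v).const_add 1
      simpa using h1.inv₀ one_ne_zero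
    simpa using (hinv (w₁ z)).mul (hinv (w₂ z))
  · intro n z hz
    have hid : innerAnalytic f z * E n z =
        w₁ z * (1 + (a n : ℂ) * w₁ z)⁻¹ * (1 + (a n : ℂ) * w₂ z)⁻¹ -
        w₂ z * (1 + (a n : ℂ) * w₂ z)⁻¹ * (1 + (a n : ℂ) * w₁ z)⁻¹ := by
      rw [hdiff z hz]
      simp only [hE_def]
      ring
    rw [hid]
    refine (norm_sub_le _ _).trans (add_le_add ?_ ?_)
    · rw [norm_mul]
      exact (mul_le_of_le_one_right (norm_nonneg _)
        (norm_inv_one_add_mul_le (ha n).le (h₂ z hz))).trans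
        (norm_mul_inv_one_add_mul_le (ha n) (h₁ z hz))
    · rw [norm_mul]
      exact (mul_le_of_le_one_right (norm_nonneg _)
        (norm_inv_one_add_mul_le (ha n).le (h₁ z hz))).trans
        (norm_mul_inv_one_add_mul_le (ha n) (h₂ z hz))

/-! ### Conjugating twice. -/

lemma ae_tendsto_re_innerAnalytic {f : ℝ → ℝ} (hf : IntegrableOn f (Icc (-Real.pi) Real.pi)) :
    ∀ᵐ θ : ℝ ∂(volume.restrict (Icc (-Real.pi) Real.pi)),
      Tendsto (fun ρ : ℝ => (innerAnalytic f ((ρ : ℂ) * Complex.exp (Complex.I * (θ : ℂ)))).re)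
        (𝓝[<] 1) (𝓝 (f θ)) := by
  filter_upwards [ae_isLebesguePoint hf, ae_mem_Ioo] with θ h1 h2
  exact tendsto_re_innerAnalytic hf h1 h2

/-- Let `X` and `Y` be the `k`-th Fourier integrals of `f` and `g`. For `k ≥ 1` the boundary
identity reads `X + iY = 2X`, so `Y = -iX`. For `k = 0` it reads `X + iY = X`, so `Y = 0`, and the
zero mean of `f` makes the other side vanish as well. -/
theorem IsFourierConjugate.taylorCoeff_eq {f g : ℝ → ℝ}
    (hf : IntegrableOn f (Icc (-Real.pi) Real.pi))
    (hg : IntegrableOn g (Icc (-Real.pi) Real.pi))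
    (hf0 : ∫ θ in Icc (-Real.pi) Real.pi, f θ = 0) (hfg : IsFourierConjugate f g) (k : ℕ) :
    taylorCoeff g k = -Complex.I * taylorCoeff f k := by
  have hlim : ∀ᵐ θ : ℝ ∂(volume.restrict (Icc (-Real.pi) Real.pi)),
      Tendsto (fun ρ : ℝ => innerAnalytic f ((ρ : ℂ) * Complex.exp (Complex.I * (θ : ℂ))))
        (𝓝[<] 1) (𝓝 ((f θ : ℂ) + Complex.I * (g θ : ℂ))) := by
    filter_upwards [ae_tendsto_re_innerAnalytic hf, hfg] with θ h1 h2
    have h3 := ((Complex.continuous_ofReal.tendsto _).comp h1).add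
      (((Complex.continuous_ofReal.tendsto _).comp h2).const_mul Complex.I)
    refine h3.congr fun ρ => ?_
    simp only [Function.comp]
    exact (congrArg _ (mul_comm _ _)).trans (Complex.re_add_im _)
  have hmain := integral_boundary_eq_taylorCoeff hf hg hlim k
  have hfi : IntegrableOn (fun θ : ℝ => Complex.exp (-(Complex.I * (θ : ℂ))) ^ k * (f θ : ℂ))
    (Icc (-Real.pi) Real.pi) := integrableOn_continuous_mul (by fun_prop) hf
  have hgi : IntegrableOn (fun θ : ℝ => Complex.exp (-(Complex.I * (θ : ℂ))) ^ k * (g θ : ℂ))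
    (Icc (-Real.pi) Real.pi) := integrableOn_continuous_mul (by fun_prop) hg
  have hsplit : ∀ θ : ℝ, ((f θ : ℂ) + Complex.I * (g θ : ℂ)) *
      Complex.exp (-(Complex.I * (θ : ℂ))) ^ k =
      Complex.exp (-(Complex.I * (θ : ℂ))) ^ k * (f θ : ℂ) +
      Complex.I * (Complex.exp (-(Complex.I * (θ : ℂ))) ^ k * (g θ : ℂ)) := fun θ => by ring
  simp_rw [hsplit] at hmain
  rw [integral_add hfi (hgi.const_mul _), integral_const_mul] at hmain
  have hpi : (Real.pi : ℂ) ≠ 0 := by exact_mod_cast Real.pi_ne_zero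
  have hF := taylorCoeff_eq_integral hf k
  have hG := taylorCoeff_eq_integral hg k
  simp_rw [mul_assoc (herglotzCoeff k)] at hF hG
  rw [integral_const_mul, integral_const_mul] at hF hG
  have hF0 : k = 0 → ∫ θ in Icc (-Real.pi) Real.pi,
      Complex.exp (-(Complex.I * (θ : ℂ))) ^ k * (f θ : ℂ) = 0 := by
    rintro rfl
    simp only [pow_zero, one_mul]
    rw [integral_complex_ofReal, hf0, Complex.ofReal_zero]
  set X := ∫ θ in Icc (-Real.pi) Real.pi, Complex.exp (-(Complex.I * (θ : ℂ))) ^ k * (f θ : ℂ)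
  set Y := ∫ θ in Icc (-Real.pi) Real.pi, Complex.exp (-(Complex.I * (θ : ℂ))) ^ k * (g θ : ℂ)
  have hI := Complex.I_mul_I
  rw [hF] at hmain
  rw [hF, hG]
  unfold herglotzCoeff at hmain ⊢
  split_ifs at hmain ⊢ with hk
  · rw [hF0 hk] at hmain ⊢
    have : Y = 0 := by simpa using hmain
    simp [this]
  · have h1 : 2 * Real.pi * ((2 * (Real.pi : ℂ))⁻¹ * (2 * X)) = 2 * X := by field_simp
    rw [h1] at hmain
    have hY : Y = -Complex.I * X := by linear_combination (-Complex.I) * hmain + Y * hI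
    rw [hY]
    ring

/-- The Fourier conjugate of an integrable Fourier conjugate of `f` is `-f`. -/
theorem IsFourierConjugate.neg_symm {f g : ℝ → ℝ}
    (hf : IntegrableOn f (Icc (-Real.pi) Real.pi))
    (hg : IntegrableOn g (Icc (-Real.pi) Real.pi))
    (hf0 : ∫ θ in Icc (-Real.pi) Real.pi, f θ = 0) (hfg : IsFourierConjugate f g) :
    IsFourierConjugate g fun θ => -f θ := by
  have hw : ∀ z, innerAnalytic g z = -Complex.I * innerAnalytic f z := by
    intro z
    simp_rw [innerAnalytic, hfg.taylorCoeff_eq hf hg hf0, mul_assoc]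
    rw [tsum_mul_left]
  -- `Im(-i w) = -Re w`, whose radial limit is `-f` by Fatou's theorem.
  filter_upwards [ae_tendsto_re_innerAnalytic hf] with θ hθ
  refine hθ.neg.congr fun ρ => ?_
  rw [hw]
  simp

end CompactHilbert

theorem theorem1 (f g : ℝ → ℝ)
    (hf : MeasureTheory.IntegrableOn f (Set.Icc (-Real.pi) Real.pi))
    (hf0 : ∫ θ in (-Real.pi)..Real.pi, f θ = 0)
    (hfg : CompactHilbert.IsFourierConjugate f g) :
    (∀ᵐ θ ∂(MeasureTheory.volume.restrict (Set.Icc (-Real.pi) Real.pi)),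
      CompactHilbert.HilbertExistsAt f θ ∧ g θ = CompactHilbert.hilbert f θ) ∧
    (MeasureTheory.IntegrableOn g (Set.Icc (-Real.pi) Real.pi) →
      ∀ᵐ θ ∂(MeasureTheory.volume.restrict (Set.Icc (-Real.pi) Real.pi)),
        CompactHilbert.HilbertExistsAt g θ ∧ f θ = CompactHilbert.hilbertInv g θ) := by
  refine ⟨hfg.ae_eq_hilbert hf, fun hg => ?_⟩
  rw [CompactHilbert.integral_eq_integral_Icc] at hf0
  -- The inversion formula is the direct formula for the conjugate pair `(g, -f)`.
  filter_upwards [(hfg.neg_symm hf hg hf0).ae_eq_hilbert hg] with θ hθ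
  exact ⟨hθ.1, by rw [CompactHilbert.hilbertInv, ← hθ.2, neg_neg]⟩
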